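/- Work over $\mathbb C$. Let $V=\mathbb C^2$ with its standard symplectic form and $W=\mathbb C^3$ with its standard (non-degenerate symmetric bilinear) orthogonal form. For $i\in\mathrm{Hom}(W,V)$ let $i^*\in\mathrm{Hom}(V,W)$ be the right adjoint, $(i(w),v)_V=(w,i^*(v))_W$; for $B\in\mathrm{End}(V)$ let $B^*$ be the right adjoint, and put $\mathfrak{sp}(1)=\{B\in \mathrm{End}(V): B=-B^*\}$, $\mathfrak p(V)=\{B\in\mathrm{End}(V): B=B^*\}$. Let $\mathrm{Sp}(1)=\mathrm{Sp}(V)$ and $\mathrm{SO}(3)=\mathrm{SO}(W)$ be the complex groups. Consider $$\rho:\mathrm{Hom}(W,V)\to\mathfrak{sp}(1),\quad i\mapsto ii^*,\qquad \mu_{(2)}:\mathfrak p(V)^{\oplus 2}\oplus\mathrm{Hom}(W,V)\to\mathfrak{sp}(1),\quad (B_1,B_2,i)\mapsto[B_1,B_2]+ii^*,$$ with the actions $g\cdot i=gi$, $g\cdot B=gBg^{-1}$ of $g\in\mathrm{Sp}(1)$ and $h\cdot i=ih^{-1}$ of $h\in\mathrm{SO}(3)$. Let $\rho^{-1}(0)$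 and $\mu_{(2)}^{-1}(0)$ be the scheme-theoretic zero fibres (defined by the ideals generated by the pull-backs of the linear forms on $\mathfrak{sp}(1)$), with coordinate rings $\mathbb C[\rho^{-1}(0)]$ and $\mathbb C[\mu_{(2)}^{-1}(0)]$ and the induced group actions. Let $x,y,z$ be the linear coordinates on $\mathfrak o(3)$ dual to a basis of $\mathfrak o(3)$ (for example a basis of weight vectors of weights $-1,0,1$ for a maximal torus of $\mathrm{SO}(3)$), and let $\mathrm{SO}(3)$ act on $\mathbb C[x,y,z]=\mathbb C[\mathfrak o(3)]$, and hence on $\mathbb C[x,y,z]/(x,y,z)^2$, through the adjoint action on $\mathfrak o(3)$. (1) For every such choice of basis there is an $\mathrm{SO}(3)$-equivariant isomorphism of $\mathbb C$-algebras $$\mathbb C[\rho^{-1}(0)]^{\mathrm{Sp}(1)}\cong\mathbb C[x,y,z]/(x,y,z)^2 .$$ (2) There is an isomorphism of schemes over $\mathbb C$ $$\mu_{(2)}^{-1}(0)/\!\!/\mathrm{Sp}(1)=\mathrm{Spec}\,\mathbb C[\mu_{(2)}^{-1}(0)]^{\mathrm{Sp}(1)}\;\cong\;\mathbb A^2\times\mathbf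 F,\qquad \mathbf F=\mathrm{Spec}\,\mathbb C[x,y,z]/(x,y,z)^2 .$$ -/

import Mathlib

open scoped Matrix

noncomputable section

namespace SO3Data

/-! ### Polynomial functions, zero fibres, and group actions on their coordinate rings -/

section General

variable {V U V' : Type} [AddCommGroup V] [Module ℂ V] [AddCommGroup U] [Module ℂ U]
  [AddCommGroup V'] [Module ℂ V']

/-- The coordinate ring `ℂ[V]` of a (finite dimensional) complex vector space `V`: the algebra of
polynomial functions on `V`, i.e. the algebra of functions generated by the linear forms. -/
def polyFun (V : Type) [AddCommGroup V] [Module ℂ V] : Subalgebra ℂ (V → ℂ) :=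
  Algebra.adjoin ℂ (Set.range fun φ : Module.Dual ℂ V => (φ : V → ℂ))

theorem linear_mem_polyFun (φ : Module.Dual ℂ V) : (fun v => φ v) ∈ polyFun V :=
  Algebra.subset_adjoin ⟨φ, rfl⟩

theorem comp_linear_mem_polyFun (L : V →ₗ[ℂ] V') (F : V' → ℂ) (hF : F ∈ polyFun V') :
    (fun v => F (L v)) ∈ polyFun V := by
  let pre : (V' → ℂ) →ₐ[ℂ] (V → ℂ) :=
    { toFun := fun F v => F (L v)
      map_one' := rfl
      map_mul' := fun _ _ => rfl
      map_zero' := rfl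
      map_add' := fun _ _ => rfl
      commutes' := fun _ => rfl }
  have h : polyFun V' ≤ (polyFun V).comap pre := by
    refine Algebra.adjoin_le ?_
    rintro _ ⟨φ, rfl⟩
    exact linear_mem_polyFun (φ.comp L)
  exact h hF

/-- Pull-back of polynomial functions along a linear map. -/
def pullback (L : V →ₗ[ℂ] V') : polyFun V' →ₐ[ℂ] polyFun V where
  toFun F := ⟨fun v => F.1 (L v), comp_linear_mem_polyFun L F.1 F.2⟩
  map_one' := rfl
  map_mul' _ _ := rfl
  map_zero' := rfl
  map_add' _ _ := rfl
  commutes' _ := rfl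

/-- A map between vector spaces is polynomial if all linear forms pull back to polynomial
functions. -/
def IsPolyMap (f : V → U) : Prop :=
  ∀ φ : Module.Dual ℂ U, (fun v => φ (f v)) ∈ polyFun V

/-- The defining ideal of the scheme-theoretic zero fibre `f⁻¹(0)` of a polynomial map
`f : V → U`: it is generated by the pull-backs along `f` of the linear forms on `U`. -/
def zeroFibreIdeal (f : V → U) (hf : IsPolyMap f) : Ideal (polyFun V) :=
  Ideal.span (Set.range fun φ : Module.Dual ℂ U => (⟨fun v => φ (f v), hf φ⟩ : polyFun V))

/-- The coordinate ring `ℂ[f⁻¹(0)]` of the scheme-theoretic zero fibre. -/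
def zeroFibreRing (f : V → U) (hf : IsPolyMap f) : Type :=
  polyFun V ⧸ zeroFibreIdeal f hf

instance (f : V → U) (hf : IsPolyMap f) : CommRing (zeroFibreRing f hf) :=
  inferInstanceAs (CommRing (polyFun V ⧸ zeroFibreIdeal f hf))

instance (f : V → U) (hf : IsPolyMap f) : Algebra ℂ (zeroFibreRing f hf) :=
  inferInstanceAs (Algebra ℂ (polyFun V ⧸ zeroFibreIdeal f hf))

/-- Restriction of polynomial functions to the zero fibre. -/
def toZeroFibre (f : V → U) (hf : IsPolyMap f) : polyFun V →ₐ[ℂ] zeroFibreRing f hf :=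
  Ideal.Quotient.mkₐ ℂ (zeroFibreIdeal f hf)

theorem toZeroFibre_surjective (f : V → U) (hf : IsPolyMap f) :
    Function.Surjective (toZeroFibre f hf) :=
  Ideal.Quotient.mk_surjective

variable {G H : Type} [Group G] [Group H]

/-- The action of `G` on `ℂ[V]` induced by a linear action on `V`: `(g F)(v) = F (g⁻¹ v)`. -/
def polyRep (σ : Representation ℂ G V) : G →* (polyFun V →ₐ[ℂ] polyFun V) where
  toFun g := pullback (σ g⁻¹)
  map_one' := by
    ext F v
    simp [pullback]
  map_mul' g h := by
    ext F v
    change F.1 (σ (g * h)⁻¹ v) = F.1 (σ h⁻¹ (σ g⁻¹ v))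
    rw [mul_inv_rev, map_mul, Module.End.mul_apply]

theorem zeroFibreIdeal_le_comap (σ : Representation ℂ G V) (τ : Representation ℂ G U) (f : V → U)
    (hf : IsPolyMap f) (heq : ∀ g v, f (σ g v) = τ g (f v)) (g : G) :
    zeroFibreIdeal f hf ≤ (zeroFibreIdeal f hf).comap (polyRep σ g) := by
  refine Ideal.span_le.2 ?_
  rintro _ ⟨φ, rfl⟩
  refine Ideal.subset_span ⟨φ.comp (τ g⁻¹), ?_⟩
  ext v
  change φ (τ g⁻¹ (f v)) = φ (f (σ g⁻¹ v))
  rw [heq]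

/-- The action of one element `g ∈ G` on `ℂ[f⁻¹(0)]` for a `G`-equivariant polynomial map `f`. -/
def zeroFibreMap (σ : Representation ℂ G V) (τ : Representation ℂ G U) (f : V → U)
    (hf : IsPolyMap f) (heq : ∀ g v, f (σ g v) = τ g (f v)) (g : G) :
    zeroFibreRing f hf →ₐ[ℂ] zeroFibreRing f hf :=
  Ideal.quotientMapₐ (zeroFibreIdeal f hf) (polyRep σ g) (zeroFibreIdeal_le_comap σ τ f hf heq g)

theorem zeroFibreMap_toZeroFibre (σ : Representation ℂ G V) (τ : Representation ℂ G U) (f : V → U)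
    (hf : IsPolyMap f) (heq : ∀ g v, f (σ g v) = τ g (f v)) (g : G) (F : polyFun V) :
    zeroFibreMap σ τ f hf heq g (toZeroFibre f hf F) = toZeroFibre f hf (polyRep σ g F) :=
  rfl

/-- The action of `G` on `ℂ[f⁻¹(0)]` for a `G`-equivariant polynomial map `f`. -/
def zeroFibreRep (σ : Representation ℂ G V) (τ : Representation ℂ G U) (f : V → U)
    (hf : IsPolyMap f) (heq : ∀ g v, f (σ g v) = τ g (f v)) :
    G →* (zeroFibreRing f hf →ₐ[ℂ] zeroFibreRing f hf) where
  toFun g := zeroFibreMap σ τ f hf heq g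
  map_one' := by
    refine AlgHom.ext fun r => ?_
    obtain ⟨F, rfl⟩ := toZeroFibre_surjective f hf r
    rw [zeroFibreMap_toZeroFibre, map_one]
    rfl
  map_mul' g h := by
    refine AlgHom.ext fun r => ?_
    obtain ⟨F, rfl⟩ := toZeroFibre_surjective f hf r
    rw [AlgHom.mul_apply, zeroFibreMap_toZeroFibre, zeroFibreMap_toZeroFibre,
      zeroFibreMap_toZeroFibre, map_mul]
    rfl

/-- The algebra of invariants `R^G`. -/
def invariants {R : Type} [CommRing R] [Algebra ℂ R] (α : G →* (R →ₐ[ℂ] R)) :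
    Subalgebra ℂ R where
  carrier := {r | ∀ g, α g r = r}
  mul_mem' ha hb g := by rw [map_mul, ha g, hb g]
  add_mem' ha hb g := by rw [map_add, ha g, hb g]
  algebraMap_mem' c g := (α g).commutes c

/-- If the actions of `G` and `H` on `R` commute, then `H` acts on `R^G`. -/
def invariantsRep {R : Type} [CommRing R] [Algebra ℂ R] (α : G →* (R →ₐ[ℂ] R))
    (β : H →* (R →ₐ[ℂ] R)) (hc : ∀ g h r, α g (β h r) = β h (α g r)) :
    H →* (invariants α →ₐ[ℂ] invariants α) where
  toFun h := ((β h).comp (invariants α).val).codRestrict (invariants α)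
    fun r g => by
      change α g (β h r.1) = β h r.1
      rw [hc, r.2 g]
  map_one' := by
    ext r
    simp
  map_mul' g h := by
    ext r
    change β (g * h) r.1 = β g (β h r.1)
    rw [map_mul, AlgHom.mul_apply]

/-- The affine GIT quotient `Spec R // G = Spec (R^G)`, as a scheme over `ℂ`. -/
def gitQuotient {R : Type} [CommRing R] [Algebra ℂ R] (α : G →* (R →ₐ[ℂ] R)) :
    CategoryTheory.Over (AlgebraicGeometry.Spec (CommRingCat.of ℂ)) :=
  CategoryTheory.Over.mk
    (AlgebraicGeometry.Spec.map (CommRingCat.ofHom (algebraMap ℂ (invariants α))))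

end General

/-! ### The polynomial ring `ℂ[x, y, z]` and the fat point -/

/-- The ideal `(x, y, z)²` of `ℂ[x, y, z]`. -/
def fatIdeal : Ideal (MvPolynomial (Fin 3) ℂ) :=
  Ideal.span {MvPolynomial.X 0, MvPolynomial.X 1, MvPolynomial.X 2} ^ 2

/-- The ring `ℂ[x, y, z] / (x, y, z)²`. -/
abbrev FatRing : Type := MvPolynomial (Fin 3) ℂ ⧸ fatIdeal

/-- The fat point `F = Spec ℂ[x, y, z] / (x, y, z)²`, as a scheme over `ℂ`. -/
def fatPoint : CategoryTheory.Over (AlgebraicGeometry.Spec (CommRingCat.of ℂ)) :=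
  CategoryTheory.Over.mk
    (AlgebraicGeometry.Spec.map (CommRingCat.ofHom (algebraMap ℂ FatRing)))

open AlgebraicGeometry CategoryTheory in
/-- The product `𝔸² × F` over `ℂ`. -/
def planeTimesFatPoint : Over (Spec (CommRingCat.of ℂ)) :=
  Over.mk (Limits.pullback.fst (𝔸(Fin 2; Spec (CommRingCat.of ℂ)) ↘ Spec (CommRingCat.of ℂ))
    fatPoint.hom ≫ (𝔸(Fin 2; Spec (CommRingCat.of ℂ)) ↘ Spec (CommRingCat.of ℂ)))

section Coordinates

variable {U : Type} [AddCommGroup U] [Module ℂ U] {G : Type} [Group G]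

/-- The action of `g` on `ℂ[U] = ℂ[x, y, z]`, where `x, y, z` are the coordinates on `U` dual to
a basis `b`: the coordinate `x_k` is sent to the linear form `u ↦ x_k (g⁻¹ u)`, written as a
linear combination of `x, y, z`. -/
def coordAct (b : Module.Basis (Fin 3) ℂ U) (σ : Representation ℂ G U) (g : G) :
    MvPolynomial (Fin 3) ℂ →ₐ[ℂ] MvPolynomial (Fin 3) ℂ :=
  MvPolynomial.aeval fun k => ∑ j, (b.coord k (σ g⁻¹ (b j))) • MvPolynomial.X j

theorem coordAct_one (b : Module.Basis (Fin 3) ℂ U) (σ : Representation ℂ G U) :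
    coordAct b σ 1 = AlgHom.id ℂ _ := by
  refine MvPolynomial.algHom_ext fun k => ?_
  simp [coordAct, Finsupp.single_apply, ite_smul]

theorem coordAct_mul (b : Module.Basis (Fin 3) ℂ U) (σ : Representation ℂ G U) (g h : G) :
    coordAct b σ (g * h) = (coordAct b σ g).comp (coordAct b σ h) := by
  refine MvPolynomial.algHom_ext fun k => ?_
  simp only [coordAct, MvPolynomial.aeval_X, AlgHom.comp_apply, map_sum, map_smul,
    Finset.smul_sum, smul_smul]
  rw [Finset.sum_comm]
  refine Finset.sum_congr rfl fun j _ => ?_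
  rw [← Finset.sum_smul]
  congr 1
  conv_lhs => rw [mul_inv_rev, map_mul, Module.End.mul_apply, ← b.sum_repr (σ g⁻¹ (b j)),
    map_sum, map_sum]
  refine Finset.sum_congr rfl fun i _ => ?_
  rw [map_smul, map_smul, smul_eq_mul, mul_comm]
  rfl

theorem fatIdeal_le_comap (b : Module.Basis (Fin 3) ℂ U) (σ : Representation ℂ G U) (g : G) :
    fatIdeal ≤ fatIdeal.comap (coordAct b σ g) := by
  have h : Ideal.span {MvPolynomial.X 0, MvPolynomial.X 1, MvPolynomial.X 2} ≤
      (Ideal.span {MvPolynomial.X 0, MvPolynomial.X 1, MvPolynomial.X 2} :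
        Ideal (MvPolynomial (Fin 3) ℂ)).comap (coordAct b σ g) := by
    have hX : ∀ j : Fin 3, (MvPolynomial.X j : MvPolynomial (Fin 3) ℂ) ∈
        (Ideal.span {MvPolynomial.X 0, MvPolynomial.X 1, MvPolynomial.X 2} :
          Ideal (MvPolynomial (Fin 3) ℂ)) := by
      intro j
      apply Ideal.subset_span
      fin_cases j <;> simp
    have hk : ∀ k : Fin 3, coordAct b σ g (MvPolynomial.X k) ∈
        (Ideal.span {MvPolynomial.X 0, MvPolynomial.X 1, MvPolynomial.X 2} :
          Ideal (MvPolynomial (Fin 3) ℂ)) := by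
      intro k
      simp only [coordAct, MvPolynomial.aeval_X]
      exact Submodule.sum_mem _ fun j _ => Submodule.smul_of_tower_mem _ _ (hX j)
    refine Ideal.span_le.2 ?_
    rintro _ (rfl | rfl | rfl)
    exacts [hk 0, hk 1, hk 2]
  exact (Ideal.pow_right_mono h 2).trans (Ideal.le_comap_pow _ 2)

/-- The action of `G` on `ℂ[x, y, z] / (x, y, z)²` induced by a linear action on `U` with
coordinates `x, y, z`. -/
def fatRep (b : Module.Basis (Fin 3) ℂ U) (σ : Representation ℂ G U) :
    G →* (FatRing →ₐ[ℂ] FatRing) where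
  toFun g := Ideal.quotientMapₐ _ (coordAct b σ g) (fatIdeal_le_comap b σ g)
  map_one' := by
    refine Ideal.Quotient.algHom_ext _ ?_
    simp only [coordAct_one]
    ext k
    simp
  map_mul' g h := by
    refine Ideal.Quotient.algHom_ext _ ?_
    simp only [coordAct_mul]
    ext k
    simp

end Coordinates

/-! ### The moment maps

`V = ℂ^l ⊕ ℂ^l` carries the standard symplectic form with matrix `J = Matrix.J l ℂ`, and
`W = ℂ³` carries the standard orthogonal form, with matrix `1`. -/

section Moment

variable (l : Type) [Fintype l] [DecidableEq l]

/-- The space `Hom(W, V)`. -/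
abbrev HomWV : Type := Matrix (l ⊕ l) (Fin 3) ℂ

/-- The symplectic group `Sp(V)`; it is `Sp(1)` when `l` has one element. -/
abbrev SpV : Type := Matrix.symplecticGroup l ℂ

/-- The complex special orthogonal group `SO(3)`. -/
abbrev SO3 : Type := Matrix.specialOrthogonalGroup (Fin 3) ℂ

/-- The Lie algebra `𝔰𝔭(V) = {B | B = -B*}` (as a vector space). -/
abbrev spV : Type := skewAdjointMatricesSubmodule (Matrix.J l ℂ)

/-- The Lie algebra `𝔬(3)` of skew-symmetric matrices (as a vector space). -/
abbrev o3 : Type := skewAdjointMatricesSubmodule (1 : Matrix (Fin 3) (Fin 3) ℂ)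

/-- The space `𝔭(V) = {B | B = B*}`. -/
abbrev pV : Type := selfAdjointMatricesSubmodule (Matrix.J l ℂ)

variable {l}

/-- The right adjoint `i* : V → W` of `i : W → V`. -/
def adj (i : HomWV l) : Matrix (Fin 3) (l ⊕ l) ℂ := iᵀ * Matrix.J l ℂ

/-- The defining property `(i w, v)_V = (w, i* v)_W` of the right adjoint. -/
theorem isAdjointPair_adj (i : HomWV l) : Matrix.IsAdjointPair 1 (Matrix.J l ℂ) i (adj i) := by
  simp [Matrix.IsAdjointPair, adj]

theorem mem_spV (B : Matrix (l ⊕ l) (l ⊕ l) ℂ) :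
    B ∈ skewAdjointMatricesSubmodule (Matrix.J l ℂ) ↔ Bᵀ * Matrix.J l ℂ = -(Matrix.J l ℂ * B) := by
  simp [Matrix.IsSkewAdjoint, Matrix.IsAdjointPair]

theorem mem_o3 (A : Matrix (Fin 3) (Fin 3) ℂ) :
    A ∈ skewAdjointMatricesSubmodule (1 : Matrix (Fin 3) (Fin 3) ℂ) ↔ Aᵀ = -A := by
  simp [Matrix.IsSkewAdjoint, Matrix.IsAdjointPair]

theorem mem_pV (B : Matrix (l ⊕ l) (l ⊕ l) ℂ) :
    B ∈ selfAdjointMatricesSubmodule (Matrix.J l ℂ) ↔ Bᵀ * Matrix.J l ℂ = Matrix.J l ℂ * B := by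
  simp [Matrix.IsSelfAdjoint, Matrix.IsAdjointPair]

theorem mul_adj_mem (i : HomWV l) : i * adj i ∈ skewAdjointMatricesSubmodule (Matrix.J l ℂ) := by
  rw [mem_spV]
  simp [adj, Matrix.mul_assoc]

/-- The map `ρ : Hom(W, V) → 𝔰𝔭(V)`, `i ↦ i i*`. -/
def rho (i : HomWV l) : spV l := ⟨i * adj i, mul_adj_mem i⟩

/-- The space `N = 𝔭(V) ⊕ 𝔭(V) ⊕ Hom(W, V)`. -/
abbrev ADHM (l : Type) [Fintype l] [DecidableEq l] : Type := pV l × pV l × HomWV l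

theorem commutator_mem (A B : pV l) : A.1 * B.1 - B.1 * A.1 ∈ skewAdjointMatricesSubmodule (Matrix.J l ℂ) := by
  have hA := (mem_pV _).1 A.2
  have hB := (mem_pV _).1 B.2
  rw [mem_spV, Matrix.transpose_sub, Matrix.transpose_mul, Matrix.transpose_mul, Matrix.sub_mul,
    Matrix.mul_assoc, Matrix.mul_assoc, hA, hB, ← Matrix.mul_assoc, ← Matrix.mul_assoc, hA, hB,
    Matrix.mul_sub, Matrix.mul_assoc, Matrix.mul_assoc, neg_sub]

/-- The moment map `μ : N → 𝔰𝔭(V)`, `(B₁, B₂, i) ↦ [B₁, B₂] + i i*`. -/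
def mu (x : ADHM l) : spV l := ⟨x.1.1 * x.2.1.1 - x.2.1.1 * x.1.1, commutator_mem _ _⟩ + rho x.2.2

theorem isPolyMap_of_entries {E : Type} [AddCommGroup E] [Module ℂ E] (f : E → spV l)
    (h : ∀ p q, (fun v => (f v).1 p q) ∈ polyFun E) : IsPolyMap f := by
  intro φ
  obtain ⟨ψ, hψ⟩ := LinearMap.exists_extend
    (p := skewAdjointMatricesSubmodule (Matrix.J l ℂ)) φ
  have key : (fun v => φ (f v)) =
      ∑ p, ∑ q, ψ (Matrix.single p q 1) • fun v => (f v).1 p q := by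
    funext v
    have h1 : φ (f v) = ψ (f v).1 := by rw [← hψ]; rfl
    rw [h1]
    conv_lhs => rw [Matrix.matrix_eq_sum_single (f v).1]
    simp only [map_sum, Finset.sum_apply, Pi.smul_apply, smul_eq_mul]
    refine Finset.sum_congr rfl fun p _ => Finset.sum_congr rfl fun q _ => ?_
    rw [mul_comm, ← smul_eq_mul, ← map_smul, Matrix.smul_single, smul_eq_mul, mul_one]
  rw [key]
  exact Subalgebra.sum_mem _ fun p _ => Subalgebra.sum_mem _ fun q _ =>
    Subalgebra.smul_mem _ (h p q) _

theorem rho_entry {E : Type} [AddCommGroup E] [Module ℂ E] (L : E →ₗ[ℂ] HomWV l)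
    (p q : l ⊕ l) : (fun v => (rho (L v)).1 p q) ∈ polyFun E := by
  have hc : ∀ a b, (fun v => L v a b) ∈ polyFun E := fun a b =>
    linear_mem_polyFun ((Matrix.entryLinearMap ℂ ℂ a b).comp L)
  have : (fun v => (rho (L v)).1 p q) =
      ∑ c, ((fun v => L v p c) * ∑ d, (Matrix.J l ℂ d q) • fun v => L v d c) := by
    funext v
    simp [rho, adj, Matrix.mul_apply, Finset.sum_apply, mul_comm]
  rw [this]
  exact Subalgebra.sum_mem _ fun c _ => Subalgebra.mul_mem _ (hc _ _)
    (Subalgebra.sum_mem _ fun d _ => Subalgebra.smul_mem _ (hc _ _) _)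

theorem isPolyMap_rho : IsPolyMap (rho (l := l)) :=
  isPolyMap_of_entries _ fun p q => rho_entry LinearMap.id p q

theorem isPolyMap_mu : IsPolyMap (mu (l := l)) := by
  refine isPolyMap_of_entries _ fun p q => ?_
  have h1 : ∀ a b, (fun x : ADHM l => x.1.1 a b) ∈ polyFun (ADHM l) := fun a b =>
    linear_mem_polyFun ((Matrix.entryLinearMap ℂ ℂ a b).comp
      ((Submodule.subtype _).comp (LinearMap.fst ℂ (pV l) (pV l × HomWV l))))
  have h2 : ∀ a b, (fun x : ADHM l => x.2.1.1 a b) ∈ polyFun (ADHM l) := fun a b =>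
    linear_mem_polyFun ((Matrix.entryLinearMap ℂ ℂ a b).comp
      ((Submodule.subtype _).comp ((LinearMap.fst ℂ (pV l) (HomWV l)).comp
        (LinearMap.snd ℂ (pV l) (pV l × HomWV l)))))
  have h3 : (fun x : ADHM l => (rho x.2.2).1 p q) ∈ polyFun (ADHM l) :=
    rho_entry ((LinearMap.snd ℂ (pV l) (HomWV l)).comp
        (LinearMap.snd ℂ (pV l) (pV l × HomWV l))) p q
  have : (fun x : ADHM l => (mu x).1 p q) =
      (∑ c, (fun x : ADHM l => x.1.1 p c) * (fun x : ADHM l => x.2.1.1 c q)) -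
      (∑ c, (fun x : ADHM l => x.2.1.1 p c) * (fun x : ADHM l => x.1.1 c q)) +
      (fun x : ADHM l => (rho x.2.2).1 p q) := by
    funext x
    simp [mu, Matrix.mul_apply, Finset.sum_apply]
  rw [this]
  exact Subalgebra.add_mem _ (Subalgebra.sub_mem _
    (Subalgebra.sum_mem _ fun c _ => Subalgebra.mul_mem _ (h1 _ _) (h2 _ _))
    (Subalgebra.sum_mem _ fun c _ => Subalgebra.mul_mem _ (h2 _ _) (h1 _ _))) h3

/-! ### The group actions -/

theorem coe_inv_mul (g : SpV l) : (g⁻¹).1 * g.1 = 1 := congrArg Subtype.val (inv_mul_cancel g)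

theorem coe_mul_inv (g : SpV l) : g.1 * (g⁻¹).1 = 1 := congrArg Subtype.val (mul_inv_cancel g)

theorem transpose_mul_J (g : SpV l) : (g.1)ᵀ * Matrix.J l ℂ = Matrix.J l ℂ * (g⁻¹).1 := by
  have h : (g.1)ᵀ * Matrix.J l ℂ * g.1 = Matrix.J l ℂ := SymplecticGroup.mem_iff'.1 g.2
  calc (g.1)ᵀ * Matrix.J l ℂ = (g.1)ᵀ * Matrix.J l ℂ * (g.1 * (g⁻¹).1) := by
        rw [coe_mul_inv, Matrix.mul_one]
    _ = Matrix.J l ℂ * (g⁻¹).1 := by rw [← Matrix.mul_assoc, h]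

theorem conj_transpose_mul_J (g : SpV l) (B : Matrix (l ⊕ l) (l ⊕ l) ℂ) :
    (g.1 * B * (g⁻¹).1)ᵀ * Matrix.J l ℂ =
      ((g⁻¹).1)ᵀ * (Bᵀ * Matrix.J l ℂ) * (g⁻¹).1 := by
  rw [Matrix.transpose_mul, Matrix.transpose_mul, Matrix.mul_assoc, Matrix.mul_assoc,
    transpose_mul_J, Matrix.mul_assoc, Matrix.mul_assoc]

theorem J_mul_conj (g : SpV l) (B : Matrix (l ⊕ l) (l ⊕ l) ℂ) :
    Matrix.J l ℂ * (g.1 * B * (g⁻¹).1) =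
      ((g⁻¹).1)ᵀ * (Matrix.J l ℂ * B) * (g⁻¹).1 := by
  have := transpose_mul_J g⁻¹
  rw [inv_inv] at this
  rw [← Matrix.mul_assoc ((g⁻¹).1)ᵀ, this]
  simp only [Matrix.mul_assoc]

/-- Conjugation by `g ∈ Sp(V)` on `End(V)`. -/
def conjSp (g : SpV l) : Matrix (l ⊕ l) (l ⊕ l) ℂ →ₗ[ℂ] Matrix (l ⊕ l) (l ⊕ l) ℂ where
  toFun B := g.1 * B * (g⁻¹).1
  map_add' A B := by simp [Matrix.mul_add, Matrix.add_mul]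
  map_smul' c B := by simp

/-- The adjoint action `B ↦ g B g⁻¹` of `Sp(V)` on `𝔰𝔭(V)`. -/
def adSp : Representation ℂ (SpV l) (spV l) where
  toFun g := (conjSp g).restrict (p := skewAdjointMatricesSubmodule (Matrix.J l ℂ))
    (q := skewAdjointMatricesSubmodule (Matrix.J l ℂ)) fun B hB => by
      have hB' := (mem_spV B).1 hB
      refine (mem_spV _).2 ?_
      change (g.1 * B * (g⁻¹).1)ᵀ * _ = -(_ * (g.1 * B * (g⁻¹).1))
      rw [conj_transpose_mul_J, J_mul_conj, hB', Matrix.mul_neg, Matrix.neg_mul]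
  map_one' := by
    refine LinearMap.ext fun B => Subtype.ext ?_
    change (1 : SpV l).1 * B.1 * ((1 : SpV l)⁻¹).1 = B.1
    simp
  map_mul' g h := by
    refine LinearMap.ext fun B => Subtype.ext ?_
    change (g * h).1 * B.1 * ((g * h)⁻¹).1 = g.1 * (h.1 * B.1 * (h⁻¹).1) * (g⁻¹).1
    simp only [mul_inv_rev, Submonoid.coe_mul, Matrix.mul_assoc]

/-- The action `B ↦ g B g⁻¹` of `Sp(V)` on `𝔭(V)`. -/
def conjP : Representation ℂ (SpV l) (pV l) where
  toFun g := (conjSp g).restrict fun B hB => by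
      have hB' := (mem_pV B).1 hB
      refine (mem_pV _).2 ?_
      change (g.1 * B * (g⁻¹).1)ᵀ * _ = _ * (g.1 * B * (g⁻¹).1)
      rw [conj_transpose_mul_J, J_mul_conj, hB']
  map_one' := by
    refine LinearMap.ext fun B => Subtype.ext ?_
    change (1 : SpV l).1 * B.1 * ((1 : SpV l)⁻¹).1 = B.1
    simp
  map_mul' g h := by
    refine LinearMap.ext fun B => Subtype.ext ?_
    change (g * h).1 * B.1 * ((g * h)⁻¹).1 = g.1 * (h.1 * B.1 * (h⁻¹).1) * (g⁻¹).1
    simp only [mul_inv_rev, Submonoid.coe_mul, Matrix.mul_assoc]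

/-- The action `i ↦ g i` of `Sp(V)` on `Hom(W, V)`. -/
def homSp : Representation ℂ (SpV l) (HomWV l) where
  toFun g :=
    { toFun := fun i => g.1 * i
      map_add' := fun A B => Matrix.mul_add _ _ _
      map_smul' := fun c B => by simp }
  map_one' := by
    ext1 i
    simp
  map_mul' g h := by
    ext1 i
    simp [Matrix.mul_assoc]

/-- The action `i ↦ i h⁻¹` of `SO(3)` on `Hom(W, V)`. -/
def homSO : Representation ℂ SO3 (HomWV l) where
  toFun h :=
    { toFun := fun i => i * (h⁻¹).1
      map_add' := fun A B => Matrix.add_mul _ _ _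
      map_smul' := fun c B => by simp }
  map_one' := by
    ext1 i
    simp
  map_mul' g h := by
    ext1 i
    simp only [LinearMap.coe_mk, AddHom.coe_mk, mul_inv_rev, Submonoid.coe_mul,
      Module.End.mul_apply, Matrix.mul_assoc]

/-- The action `(B₁, B₂, i) ↦ (g B₁ g⁻¹, g B₂ g⁻¹, g i)` of `Sp(V)` on `N`. -/
def admSp : Representation ℂ (SpV l) (ADHM l) where
  toFun g := (conjP g).prodMap ((conjP g).prodMap (homSp g))
  map_one' := by
    refine LinearMap.ext fun x => ?_
    simp
  map_mul' g h := by
    refine LinearMap.ext fun x => ?_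
    simp

theorem SO3.mul_transpose (h : SO3) : h.1 * (h.1)ᵀ = 1 :=
  (Matrix.mem_orthogonalGroup_iff (Fin 3) ℂ).1 (Matrix.mem_specialOrthogonalGroup_iff.1 h.2).1

theorem SO3.transpose_mul (h : SO3) : (h.1)ᵀ * h.1 = 1 :=
  (Matrix.mem_orthogonalGroup_iff' (Fin 3) ℂ).1 (Matrix.mem_specialOrthogonalGroup_iff.1 h.2).1

theorem SO3.coe_inv (h : SO3) : (h⁻¹).1 = (h.1)ᵀ := rfl

/-- The adjoint action `A ↦ h A h⁻¹` of `SO(3)` on `𝔬(3)`. -/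
def adSO : Representation ℂ SO3 o3 where
  toFun h :=
    { toFun := fun A => ⟨h.1 * A.1 * (h⁻¹).1, by
        rw [mem_o3, SO3.coe_inv, Matrix.transpose_mul, Matrix.transpose_mul,
          (mem_o3 A.1).1 A.2, Matrix.transpose_transpose,
          Matrix.neg_mul, Matrix.mul_neg, Matrix.mul_assoc]⟩
      map_add' := fun A B => Subtype.ext (by simp [Matrix.mul_add, Matrix.add_mul])
      map_smul' := fun c B => Subtype.ext (by simp) }
  map_one' := by
    refine LinearMap.ext fun A => Subtype.ext ?_
    simp
  map_mul' g h := by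
    refine LinearMap.ext fun A => Subtype.ext ?_
    change (g * h).1 * A.1 * ((g * h)⁻¹).1 = g.1 * (h.1 * A.1 * (h⁻¹).1) * (g⁻¹).1
    simp only [mul_inv_rev, Submonoid.coe_mul, Matrix.mul_assoc]

/-! ### Equivariance, and the induced actions on the coordinate rings -/

theorem rho_homSp (g : SpV l) (i : HomWV l) : rho (homSp g i) = adSp g (rho i) := by
  apply Subtype.ext
  change g.1 * i * ((g.1 * i)ᵀ * Matrix.J l ℂ) = g.1 * (i * (iᵀ * Matrix.J l ℂ)) * (g⁻¹).1
  rw [Matrix.transpose_mul, Matrix.mul_assoc iᵀ, transpose_mul_J]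
  simp only [Matrix.mul_assoc]

theorem rho_homSO (h : SO3) (i : HomWV l) :
    rho (homSO h i) = Representation.trivial ℂ SO3 (spV l) h (rho i) := by
  apply Subtype.ext
  change i * (h⁻¹).1 * ((i * (h⁻¹).1)ᵀ * Matrix.J l ℂ) = i * (iᵀ * Matrix.J l ℂ)
  rw [Matrix.transpose_mul, Matrix.mul_assoc i, ← Matrix.mul_assoc (h⁻¹).1,
    ← Matrix.mul_assoc (h⁻¹).1, SO3.mul_transpose, Matrix.one_mul]

theorem mu_admSp (g : SpV l) (x : ADHM l) : mu (admSp g x) = adSp g (mu x) := by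
  obtain ⟨A, B, i⟩ := x
  have hconj : ∀ A B : Matrix (l ⊕ l) (l ⊕ l) ℂ,
      g.1 * A * (g⁻¹).1 * (g.1 * B * (g⁻¹).1) = g.1 * (A * B) * (g⁻¹).1 := by
    intro A B
    calc _ = g.1 * A * ((g⁻¹).1 * g.1) * (B * (g⁻¹).1) := by simp only [Matrix.mul_assoc]
      _ = _ := by rw [coe_inv_mul, Matrix.mul_one]; simp only [Matrix.mul_assoc]
  rw [mu, mu, map_add]
  congr 1
  · apply Subtype.ext
    change g.1 * A.1 * (g⁻¹).1 * (g.1 * B.1 * (g⁻¹).1) -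
      g.1 * B.1 * (g⁻¹).1 * (g.1 * A.1 * (g⁻¹).1) =
      g.1 * (A.1 * B.1 - B.1 * A.1) * (g⁻¹).1
    rw [hconj, hconj, Matrix.mul_sub, Matrix.sub_mul]
  · exact rho_homSp g i

variable (l) in
/-- The coordinate ring `ℂ[ρ⁻¹(0)]`. -/
abbrev RhoRing : Type := zeroFibreRing (rho (l := l)) isPolyMap_rho

variable (l) in
/-- The coordinate ring `ℂ[μ⁻¹(0)]`. -/
abbrev MuRing : Type := zeroFibreRing (mu (l := l)) isPolyMap_mu

variable (l) in
/-- The action of `Sp(V)` on `ℂ[ρ⁻¹(0)]`. -/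
def rhoSp : SpV l →* (RhoRing l →ₐ[ℂ] RhoRing l) :=
  zeroFibreRep homSp adSp rho isPolyMap_rho rho_homSp

variable (l) in
/-- The action of `SO(3)` on `ℂ[ρ⁻¹(0)]`. -/
def rhoSO : SO3 →* (RhoRing l →ₐ[ℂ] RhoRing l) :=
  zeroFibreRep homSO (Representation.trivial ℂ SO3 (spV l)) rho isPolyMap_rho rho_homSO

variable (l) in
/-- The action of `Sp(V)` on `ℂ[μ⁻¹(0)]`. -/
def muSp : SpV l →* (MuRing l →ₐ[ℂ] MuRing l) :=
  zeroFibreRep admSp adSp mu isPolyMap_mu mu_admSp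

theorem rhoSp_rhoSO_comm (g : SpV l) (h : SO3) (r : RhoRing l) :
    rhoSp l g (rhoSO l h r) = rhoSO l h (rhoSp l g r) := by
  obtain ⟨F, rfl⟩ := toZeroFibre_surjective _ _ r
  refine congrArg (toZeroFibre _ _) (Subtype.ext (funext fun i => ?_))
  change F.1 ((g⁻¹).1 * i * (h⁻¹⁻¹).1) = F.1 ((g⁻¹).1 * (i * (h⁻¹⁻¹).1))
  rw [Matrix.mul_assoc]

variable (l) in
/-- The ring of invariants `ℂ[ρ⁻¹(0)]^{Sp(V)}`. -/
abbrev RhoInv : Type := invariants (rhoSp l)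

variable (l) in
/-- The GIT quotient `μ⁻¹(0) // Sp(V)`. -/
def muQuotient : CategoryTheory.Over (AlgebraicGeometry.Spec (CommRingCat.of ℂ)) :=
  gitQuotient (muSp l)

variable (l) in
/-- The action of `SO(3)` on `ℂ[ρ⁻¹(0)]^{Sp(V)}`. -/
def rhoInvSO : SO3 →* (RhoInv l →ₐ[ℂ] RhoInv l) :=
  invariantsRep (rhoSp l) (rhoSO l) rhoSp_rhoSO_comm

end Moment

end SO3Data

end

/-! Write $i$ as a $2\times 3$ matrix. Since $ii^*=ii^TJ$ with $J$ invertible, the ideal of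
$\rho^{-1}(0)$ is the ideal $I$ generated by the scalar products of the two rows. As
$\mathrm{Sp}(1)=\mathrm{SL}_2$ acts on the rows, the three $2\times 2$ minors $m_k$ are invariant,
and by Lagrange's identity $m_km_l\in I$ (`minor_mul_minor_mem`). It remains to see that
$1,m_1,m_2,m_3$ form a basis of the invariants of the quotient ring.

Spanning rests on the Capelli operator $\Delta=\sum_k m_k\Omega_k$, computed modulo $I$, with no
need for a Reynolds operator. Let $f$ be homogeneous of degree $n$ and invariant modulo $I$ under
the two unipotent subgroups. Differentiation puts both off-diagonal polarizations of $f$ in $I$. The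
Capelli identity (`capelli_eq`) then gives $4\Delta f\equiv n(n+2)f$, the Casimir eigenvalue of an
$\mathfrak{sl}_2$-invariant. On the other hand $m_km_l\in I$ forces $\Delta^2f\equiv n\Delta f$
(`capelli_capelli_sub_mem`). Together these yield $n^2(n+2)(n-2)f\in I$, so only degrees $0$ and $2$
survive. In degree $2$ the first relation expresses $f$ through the minors. Independence
(`coeff_eq_zero_of_mem`) is detected by the values at the origin of $f$ and of the $\Omega_kf$.

The coefficients lie in an arbitrary $\mathbb C$-algebra $A$, which settles both statements at once.
For $\mathrm{Sp}(1)$ the space $\mathfrak p(V)$ consists of scalars, so $\mu_{(2)}$ is $\rho$ after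
projection and $A=\mathbb C[\mathbb A^2]$, while $A=\mathbb C$ for $\rho$. The
$\mathrm{SO}(3)$-action is identified through the equivariant map $i\mapsto i^TJi$ to $\mathfrak
o(3)$, whose coordinates are the minors. -/

noncomputable section

/-! ### Pairs of vectors in three-space: polarizations, minors and the Capelli identity -/

namespace PairInvariants

open MvPolynomial

/-- Indices of the entries of a `2 × 3` matrix. -/
abbrev Entry : Type := (Fin 1 ⊕ Fin 1) × Fin 3

variable (A : Type) [CommRing A]

/-- The index of the first row. -/
abbrev top : Fin 1 ⊕ Fin 1 := Sum.inl 0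

/-- The index of the second row. -/
abbrev bot : Fin 1 ⊕ Fin 1 := Sum.inr 0

/-- The polarization operator `∑ k, x_{pk} ∂/∂x_{qk}`. -/
def polarize (p q : Fin 1 ⊕ Fin 1) : Derivation A (MvPolynomial Entry A) (MvPolynomial Entry A) :=
  ∑ k : Fin 3, (X (p, k) : MvPolynomial Entry A) • pderiv (q, k)

/-- The scalar product of the rows `p` and `q`. -/
def gram (p q : Fin 1 ⊕ Fin 1) : MvPolynomial Entry A := ∑ k, X (p, k) * X (q, k)

/-- The components of the cross product of the two rows, i.e. the `2 × 2` minors. -/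
def minor (k : Fin 3) : MvPolynomial Entry A :=
  X (top, k + 1) * X (bot, k + 2) - X (top, k + 2) * X (bot, k + 1)

/-- Cayley's operators, the minors in the partial derivatives. -/
def omega (k : Fin 3) (f : MvPolynomial Entry A) : MvPolynomial Entry A :=
  pderiv (top, k + 1) (pderiv (bot, k + 2) f) - pderiv (top, k + 2) (pderiv (bot, k + 1) f)

/-- The operator `∑ k, m_k Ω_k`. -/
def capelli (f : MvPolynomial Entry A) : MvPolynomial Entry A := ∑ k, minor A k * omega A k f

/-- The ideal generated by the scalar products of the rows. -/
def gramIdeal : Ideal (MvPolynomial Entry A) :=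
  Ideal.span {gram A top top, gram A top bot, gram A bot bot}

variable {A}

/-! ### Commutation relations of the polarizations and the Capelli identity -/

theorem polarize_apply (p q : Fin 1 ⊕ Fin 1) (f : MvPolynomial Entry A) :
    polarize A p q f = ∑ k, X (p, k) * pderiv (q, k) f := by
  simp only [polarize, Fin.sum_univ_three, Derivation.add_apply, Derivation.smul_apply, smul_eq_mul]

theorem polarize_X (p q r : Fin 1 ⊕ Fin 1) (j : Fin 3) :
    polarize A p q (X (r, j)) = if r = q then X (p, j) else 0 := by
  rw [polarize_apply]
  by_cases h : r = q
  · subst h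
    simp [pderiv_X, Pi.single_apply]
  · simp [pderiv_X, h]

/-- The partial derivatives, as derivations over `A`. -/
abbrev partialD (x : Entry) : Derivation A (MvPolynomial Entry A) (MvPolynomial Entry A) := pderiv x

theorem pderiv_comm (x y : Entry) (f : MvPolynomial Entry A) :
    pderiv x (pderiv y f) = pderiv y (pderiv x f) := by
  have h : ⁅partialD (A := A) x, partialD (A := A) y⁆ = 0 := by
    refine derivation_ext fun z => ?_
    rw [Derivation.commutator_apply]
    simp [pderiv_X, Pi.single_apply, apply_ite]
  have := congrArg (fun D : Derivation A (MvPolynomial Entry A) (MvPolynomial Entry A) => D f) h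
  rw [Derivation.commutator_apply] at this
  exact sub_eq_zero.1 this

/-- A commutator of derivations is a derivation, so it suffices to compare on the variables. This is
the relation $[e,f]=h$ of $\mathfrak{sl}_2$. -/
theorem polarize_commutator (f : MvPolynomial Entry A) :
    polarize A top bot (polarize A bot top f) - polarize A bot top (polarize A top bot f) =
      polarize A top top f - polarize A bot bot f := by
  have h : ⁅polarize A top bot, polarize A bot top⁆ = polarize A top top - polarize A bot bot := by
    refine derivation_ext fun z => ?_
    obtain ⟨r, j⟩ := z
    rw [Derivation.commutator_apply, Derivation.sub_apply]
    obtain r | r := r <;> fin_cases r <;> simp [polarize_X]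
  rw [← Derivation.commutator_apply, h, Derivation.sub_apply]

/-- By Cauchy–Binet, $\sum_k m_k\Omega_k$ is the $2\times 2$ determinant of polarizations with all
derivatives moved to the right. The term `polarize A top top f` compensates for the derivative in
`polarize A top bot` hitting the variables of `polarize A bot top`. -/
theorem capelli_eq (f : MvPolynomial Entry A) :
    capelli A f = polarize A top top (polarize A bot bot f) + polarize A top top f -
      polarize A top bot (polarize A bot top f) := by
  have h : ∀ j k : Fin 3, pderiv (bot, j) (pderiv (top, k) f) =
      pderiv (top, k) (pderiv (bot, j) f) := fun j k => pderiv_comm _ _ _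
  simp only [capelli, minor, omega, polarize_apply, Fin.sum_univ_three, map_add, pderiv_mul,
    pderiv_X, Pi.single_apply, Prod.mk.injEq, reduceCtorEq, false_and, if_false, h]
  simp only [Fin.isValue, true_and, zero_mul, zero_add, Fin.reduceEq, if_true, if_false, one_mul,
    Fin.reduceAdd]
  ring

/-- Replacing one row of a determinant by the other makes the rows equal. -/
theorem polarize_minor_eq_zero (k : Fin 3) :
    polarize A top bot (minor A k) = 0 ∧ polarize A bot top (minor A k) = 0 := by
  constructor <;>
  · simp [minor, polarize_X]
    ring

theorem polarize_minor_self (k : Fin 3) :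
    polarize A top top (minor A k) = minor A k ∧ polarize A bot bot (minor A k) = minor A k := by
  constructor <;>
  · simp [minor, polarize_X]
    try ring

/-- A minor is killed by the off-diagonal polarizations and has weight one in each row. Moving it to
the left in the Capelli identity therefore shifts both diagonal polarizations by one. -/
theorem capelli_minor_mul (k : Fin 3) (g : MvPolynomial Entry A) :
    capelli A (minor A k * g) = minor A k * (capelli A g +
      (polarize A top top g + polarize A bot bot g) + 2 * g) := by
  simp only [capelli_eq, Derivation.leibniz, smul_eq_mul, map_add, polarize_minor_eq_zero,
    polarize_minor_self, mul_zero, add_zero]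
  ring

theorem euler_pderiv (x : Entry) (f : MvPolynomial Entry A) :
    polarize A top top (pderiv x f) + polarize A bot bot (pderiv x f) =
      pderiv x (polarize A top top f + polarize A bot bot f) - pderiv x f := by
  have h : ⁅polarize A top top + polarize A bot bot, partialD (A := A) x⁆ = - partialD (A := A) x := by
    refine derivation_ext fun z => ?_
    obtain ⟨r, j⟩ := z
    have hN : (polarize A top top + polarize A bot bot) (X (r, j)) = X (r, j) := by
      obtain r | r := r <;> fin_cases r <;> simp [polarize_X]
    rw [Derivation.commutator_apply, hN, Derivation.neg_apply, pderiv_X]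
    by_cases hx : (r, j) = x
    · subst hx
      simp
    · simp [hx]
  have := congrArg (fun D : Derivation A (MvPolynomial Entry A) (MvPolynomial Entry A) => D f) h
  simp only [Derivation.commutator_apply, Derivation.add_apply, Derivation.neg_apply] at this
  rw [sub_eq_iff_eq_add] at this
  rw [this]
  ring

/-- Each $\Omega_k$ lowers the degree by two. The form with Euler operators avoids the natural
number $n-2$ for small $n$. -/
theorem euler_omega (k : Fin 3) (f : MvPolynomial Entry A) :
    polarize A top top (omega A k f) + polarize A bot bot (omega A k f) =
      omega A k (polarize A top top f + polarize A bot bot f) - 2 * omega A k f := by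
  have h : ∀ x y, polarize A top top (pderiv x (pderiv y f)) +
      polarize A bot bot (pderiv x (pderiv y f)) =
      pderiv x (pderiv y (polarize A top top f + polarize A bot bot f)) -
        2 * pderiv x (pderiv y f) := by
    intro x y
    rw [euler_pderiv, euler_pderiv, map_sub]
    ring
  simp only [omega, map_sub]
  linear_combination h (top, k + 1) (bot, k + 2) - h (top, k + 2) (bot, k + 1)

theorem euler_of_isHomogeneous {f : MvPolynomial Entry A} {n : ℕ} (hf : f.IsHomogeneous n) :
    polarize A top top f + polarize A bot bot f = n * f := by
  have := hf.sum_X_mul_pderiv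
  rw [Fintype.sum_prod_type, Fintype.sum_sum_type] at this
  simpa [polarize_apply] using this

/-! ### Calculations modulo the ideal of scalar products -/

theorem minor_mul_minor_mem (k l : Fin 3) : minor A k * minor A l ∈ gramIdeal A := by
  have h0 : gram A top top ∈ gramIdeal A := Ideal.subset_span (by simp)
  have h1 : gram A top bot ∈ gramIdeal A := Ideal.subset_span (by simp)
  have h2 : gram A bot bot ∈ gramIdeal A := Ideal.subset_span (by simp)
  -- Polarized Lagrange identity for the product of two components of the cross product, with its
  -- terms distributed over the three generators.
  have key : minor A k * minor A l =
      ((if k = l then gram A bot bot else 0) - X (bot, k) * X (bot, l)) * gram A top top +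
      (X (top, k) * X (bot, l) + X (bot, k) * X (top, l) -
        (if k = l then gram A top bot else 0)) * gram A top bot +
      (- X (top, k) * X (top, l)) * gram A bot bot := by
    fin_cases k <;> fin_cases l <;>
    · simp [minor, gram, Fin.sum_univ_three]
      ring
  rw [key]
  exact add_mem (add_mem (Ideal.mul_mem_left _ _ h0) (Ideal.mul_mem_left _ _ h1))
    (Ideal.mul_mem_left _ _ h2)

/-- A polarization sends each scalar product of rows to a sum of such products; the Leibniz rule
extends this to the ideal. -/
theorem polarize_mem {f : MvPolynomial Entry A} (hf : f ∈ gramIdeal A) (p q : Fin 1 ⊕ Fin 1) :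
    polarize A p q f ∈ gramIdeal A := by
  have h0 : gram A top top ∈ gramIdeal A := Ideal.subset_span (by simp)
  have h1 : gram A top bot ∈ gramIdeal A := Ideal.subset_span (by simp)
  have h2 : gram A bot bot ∈ gramIdeal A := Ideal.subset_span (by simp)
  have h3 : gram A bot top ∈ gramIdeal A := by
    simpa only [gram, mul_comm] using h1
  have hg : ∀ r s, gram A r s ∈ gramIdeal A := by
    rintro (r | r) (s | s) <;> fin_cases r <;> fin_cases s <;> assumption
  have hD : ∀ r s, polarize A p q (gram A r s) ∈ gramIdeal A := by
    intro r s
    have : polarize A p q (gram A r s) =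
        (if r = q then gram A p s else 0) + (if s = q then gram A r p else 0) := by
      simp only [gram, map_sum, Derivation.leibniz, smul_eq_mul, polarize_X]
      split_ifs <;> simp [Finset.sum_add_distrib, mul_comm, add_comm]
    rw [this]
    refine add_mem ?_ ?_ <;> split_ifs <;> simp [hg]
  refine Submodule.span_induction ?_ (by simp) ?_ ?_ hf
  · rintro _ (rfl | rfl | rfl) <;> exact hD _ _
  · intro x y _ _ hx hy
    rw [map_add]
    exact add_mem hx hy
  · intro c x hx hDx
    rw [smul_eq_mul, Derivation.leibniz, smul_eq_mul, smul_eq_mul]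
    exact add_mem (Ideal.mul_mem_left _ _ hDx) (Ideal.mul_mem_right _ _ hx)

theorem capelli_mem {f : MvPolynomial Entry A} (hf : f ∈ gramIdeal A) :
    capelli A f ∈ gramIdeal A := by
  rw [capelli_eq]
  exact sub_mem (add_mem (polarize_mem (polarize_mem hf _ _) _ _) (polarize_mem hf _ _))
    (polarize_mem (polarize_mem hf _ _) _ _)

/-- In $\Delta(m_k\,\Omega_kf)$ the degree shift contributes $(n-2)+2=n$ times $m_k\,\Omega_kf$.
What remains is $m_k\,\Delta(\Omega_kf)$, a combination of the products $m_km_l$. -/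
theorem capelli_capelli_sub_mem {f : MvPolynomial Entry A} {n : ℕ} (hf : f.IsHomogeneous n) :
    capelli A (capelli A f) - n * capelli A f ∈ gramIdeal A := by
  have key : capelli A (capelli A f) - n * capelli A f =
      ∑ k, minor A k * capelli A (omega A k f) := by
    have hsum : ∀ F : Fin 3 → MvPolynomial Entry A,
        capelli A (∑ k, F k) = ∑ k, capelli A (F k) := by
      intro F
      simp only [capelli_eq, map_sum, Finset.sum_add_distrib, Finset.sum_sub_distrib]
    have hc : capelli A f = ∑ k, minor A k * omega A k f := rfl
    conv_lhs => rw [hc, hsum, Finset.mul_sum, ← Finset.sum_sub_distrib]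
    refine Finset.sum_congr rfl fun k _ => ?_
    have h2 : omega A k ((n : MvPolynomial Entry A) * f) = n * omega A k f := by
      simp [omega, mul_sub]
    rw [capelli_minor_mul, euler_omega, euler_of_isHomogeneous hf, h2]
    ring
  rw [key]
  refine sum_mem fun k _ => ?_
  rw [capelli, Finset.mul_sum]
  refine sum_mem fun l _ => ?_
  rw [← mul_assoc]
  exact Ideal.mul_mem_right _ _ (minor_mul_minor_mem k l)

/-- Modulo the ideal the commutator relation equates the two diagonal polarizations of $f$, and
Euler's formula makes each of them $n/2$ times $f$. The Capelli identity then has the value $\frac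
n2(\frac n2+1)f$; the factor $4$ clears denominators. -/
theorem four_mul_capelli_sub_mem {f : MvPolynomial Entry A} {n : ℕ} (hf : f.IsHomogeneous n)
    (hE : polarize A top bot f ∈ gramIdeal A) (hF : polarize A bot top f ∈ gramIdeal A) :
    4 * capelli A f - n * (n + 2) * f ∈ gramIdeal A := by
  have hH : polarize A top top f - polarize A bot bot f ∈ gramIdeal A := by
    rw [← polarize_commutator]
    exact sub_mem (polarize_mem hF _ _) (polarize_mem hE _ _)
  have hN := euler_of_isHomogeneous hf
  have hN' : polarize A top top (polarize A bot bot f) =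
      n * polarize A top top f - polarize A top top (polarize A top top f) := by
    rw [← sub_eq_iff_eq_add'.2 hN.symm, map_sub, Derivation.leibniz]
    simp
  have hT := polarize_mem hH top top
  have key : 4 * capelli A f - n * (n + 2) * f =
      (n + 2) * (polarize A top top f - polarize A bot bot f) -
      2 * polarize A top top (polarize A top top f - polarize A bot bot f) -
      4 * polarize A top bot (polarize A bot top f) := by
    rw [capelli_eq, map_sub, hN']
    linear_combination ((n : MvPolynomial Entry A) + 2) * hN
  rw [key]
  exact sub_mem (sub_mem (Ideal.mul_mem_left _ _ hH) (Ideal.mul_mem_left _ _ hT))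
    (Ideal.mul_mem_left _ _ (polarize_mem hF _ _))

theorem capelli_natCast_mul (m : ℕ) (f : MvPolynomial Entry A) :
    capelli A (m * f) = m * capelli A f := by
  simp [capelli_eq]
  ring

/-- Elimination of $\Delta f$ and $\Delta^2f$ from $4\Delta f\equiv n(n+2)f$ and $\Delta^2f\equiv
n\Delta f$. The factor is $n(n+2)\cdot(n(n+2)-4n)$. -/
theorem mul_mem_gramIdeal {f : MvPolynomial Entry A} {n : ℕ} (hf : f.IsHomogeneous n)
    (hE : polarize A top bot f ∈ gramIdeal A) (hF : polarize A bot top f ∈ gramIdeal A) :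
    ((n : MvPolynomial Entry A) ^ 2 * (n + 2) * (n - 2)) * f ∈ gramIdeal A := by
  have h1 := four_mul_capelli_sub_mem hf hE hF
  have h2 := capelli_capelli_sub_mem hf
  have h3 := capelli_mem h1
  have hlin : capelli A (4 * capelli A f - n * (n + 2) * f) =
      4 * capelli A (capelli A f) - n * (n + 2) * capelli A f := by
    have h4 := capelli_natCast_mul 4 (capelli A f)
    have hn := capelli_natCast_mul (n * (n + 2)) f
    push_cast at h4 hn
    rw [← h4, ← hn]
    simp only [capelli_eq, map_sub]
    ring
  rw [hlin] at h3
  have key : ((n : MvPolynomial Entry A) ^ 2 * (n + 2) * (n - 2)) * f =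
      16 * (capelli A (capelli A f) - n * capelli A f) -
      4 * (4 * capelli A (capelli A f) - n * (n + 2) * capelli A f) -
      (n * (n + 2) - 4 * n) * (4 * capelli A f - n * (n + 2) * f) := by
    ring
  rw [key]
  exact sub_mem (sub_mem (Ideal.mul_mem_left _ _ h2) (Ideal.mul_mem_left _ _ h3))
    (Ideal.mul_mem_left _ _ h1)

/-! ### Homogeneous components and one-parameter substitutions -/

theorem homogeneousComponent_mem_gramIdeal {f : MvPolynomial Entry A} (hf : f ∈ gramIdeal A)
    (n : ℕ) : homogeneousComponent n f ∈ gramIdeal A := by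
  let _ := gradedAlgebra (σ := Entry) (R := A)
  have hI : (gramIdeal A).IsHomogeneous (homogeneousSubmodule Entry A) := by
    refine Ideal.homogeneous_span _ _ ?_
    have hg : ∀ p q, SetLike.IsHomogeneousElem (homogeneousSubmodule Entry A) (gram A p q) :=
      fun p q => ⟨2, IsHomogeneous.sum _ _ _ fun k _ => (isHomogeneous_X A _).mul
        (isHomogeneous_X A _)⟩
    rintro _ (rfl | rfl | rfl) <;> exact hg _ _
  exact homogeneousComponent_mem_of_mem hI hf n

/-- A linear endomorphism preserving degrees commutes with taking homogeneous components. -/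
theorem homogeneousComponent_map {σ : Type} (T : MvPolynomial σ A →ₗ[A] MvPolynomial σ A)
    (hT : ∀ n f, f.IsHomogeneous n → (T f).IsHomogeneous n) (n : ℕ) (f : MvPolynomial σ A) :
    homogeneousComponent n (T f) = T (homogeneousComponent n f) := by
  conv_lhs => rw [← sum_homogeneousComponent f, map_sum, map_sum]
  rw [Finset.sum_congr rfl fun i _ => homogeneousComponent_of_mem
    (hT i _ (homogeneousComponent_isHomogeneous i f)), Finset.sum_ite_eq]
  split_ifs with h
  · rfl
  · rw [homogeneousComponent_eq_zero _ _ (by simpa using h), map_zero]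

/-- The substitution which adds `T` times the row `p` to the row `q`, for an indeterminate `T`. -/
def genericShear (p q : Fin 1 ⊕ Fin 1) :
    MvPolynomial Entry A →ₐ[A] Polynomial (MvPolynomial Entry A) :=
  aeval fun x => Polynomial.C (X x) +
    if x.1 = q then Polynomial.X * Polynomial.C (X (p, x.2)) else 0

/-- The polarization is the derivative at $T=0$ of the one-parameter substitution. -/
theorem coeff_genericShear {p q : Fin 1 ⊕ Fin 1} (f : MvPolynomial Entry A) :
    (genericShear p q f).coeff 0 = f ∧ (genericShear p q f).coeff 1 = polarize A p q f := by
  induction f using MvPolynomial.induction_on with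
  | C c =>
    rw [← MvPolynomial.algebraMap_eq, AlgHom.commutes]
    simp [Polynomial.algebraMap_apply, Polynomial.coeff_C]
  | add f g hf hg => simp [hf, hg]
  | mul_X f x hf =>
    obtain ⟨r, j⟩ := x
    have h0 : (genericShear p q (X (r, j) : MvPolynomial Entry A)).coeff 0 = X (r, j) := by
      simp only [genericShear, aeval_X]
      split_ifs <;> simp
    have h1 : (genericShear p q (X (r, j) : MvPolynomial Entry A)).coeff 1 =
        polarize A p q (X (r, j)) := by
      simp only [genericShear, aeval_X, polarize_X]
      split_ifs <;> simp [Polynomial.coeff_C]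
    rw [map_mul, Polynomial.mul_coeff_zero, Polynomial.mul_coeff_one, hf.1, hf.2, h0, h1,
      Derivation.leibniz, smul_eq_mul, smul_eq_mul]
    exact ⟨rfl, by ring⟩

/-! ### Invariants modulo the ideal: spanning and independence -/

variable [Algebra ℂ A]

theorem mem_of_natCast_mul_mem {f : MvPolynomial Entry A} {n : ℕ} (hn : n ≠ 0)
    (h : (n : MvPolynomial Entry A) * f ∈ gramIdeal A) : f ∈ gramIdeal A := by
  have h2 : algebraMap ℂ (MvPolynomial Entry A) (n : ℂ)⁻¹ * (n : MvPolynomial Entry A) = 1 := by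
    rw [← map_natCast (algebraMap ℂ (MvPolynomial Entry A)) n, ← map_mul,
      inv_mul_cancel₀ (Nat.cast_ne_zero.2 hn), map_one]
  have := Ideal.mul_mem_left (gramIdeal A) (algebraMap ℂ (MvPolynomial Entry A) (n : ℂ)⁻¹) h
  rwa [← mul_assoc, h2, one_mul] at this

/-- A homogeneous polynomial which is annihilated modulo the ideal by both polarizations is
congruent to a linear combination of `1` and the minors. -/
theorem exists_of_isHomogeneous {f : MvPolynomial Entry A} {n : ℕ} (hf : f.IsHomogeneous n)
    (hE : polarize A top bot f ∈ gramIdeal A) (hF : polarize A bot top f ∈ gramIdeal A) :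
    ∃ (c₀ : A) (c : Fin 3 → A), f - (C c₀ + ∑ k, C (c k) * minor A k) ∈ gramIdeal A := by
  rcases Nat.eq_zero_or_pos n with rfl | hn
  · rw [← mem_homogeneousSubmodule, homogeneousSubmodule_zero] at hf
    obtain ⟨c, rfl⟩ := Submodule.mem_one.1 hf
    exact ⟨c, 0, by simp [MvPolynomial.algebraMap_eq]⟩
  -- In degree $2$ the eliminated factor vanishes, but the relation $4\Delta f\equiv 8f$ still
  -- expresses $f$ by minors, since the $\Omega_kf$ are constants.
  by_cases h2 : n = 2
  · subst h2
    have h1 := four_mul_capelli_sub_mem hf hE hF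
    have hO : ∀ k, ∃ c : A, omega A k f = C c := by
      intro k
      have : (omega A k f).IsHomogeneous 0 := hf.pderiv.pderiv.sub hf.pderiv.pderiv
      rw [← mem_homogeneousSubmodule, homogeneousSubmodule_zero] at this
      obtain ⟨c, hc⟩ := Submodule.mem_one.1 this
      exact ⟨c, hc.symm⟩
    choose c hc using hO
    have hhalf : C (algebraMap ℂ A (1 / 2)) * 2 = (1 : MvPolynomial Entry A) := by
      have : algebraMap ℂ A (1 / 2) * 2 = 1 := by
        rw [← map_ofNat (algebraMap ℂ A) 2, ← map_mul]
        norm_num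
      rw [← map_ofNat (C : A →+* MvPolynomial Entry A) 2, ← map_mul, this, map_one]
    refine ⟨0, fun k => algebraMap ℂ A (1 / 2) * c k, ?_⟩
    refine mem_of_natCast_mul_mem (n := 8) (by norm_num) ?_
    have key : ((8 : ℕ) : MvPolynomial Entry A) * (f - (C 0 +
        ∑ k, C (algebraMap ℂ A (1 / 2) * c k) * minor A k)) =
        -(4 * capelli A f - ((2 : ℕ) : MvPolynomial Entry A) * (((2 : ℕ) : MvPolynomial Entry A) + 2) * f) := by
      have : ∑ k, C (algebraMap ℂ A (1 / 2) * c k) * minor A k =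
          C (algebraMap ℂ A (1 / 2)) * capelli A f := by
        rw [capelli, Finset.mul_sum]
        refine Finset.sum_congr rfl fun k _ => ?_
        rw [hc, map_mul]
        ring
      rw [this, map_zero]
      push_cast
      linear_combination (-4 * capelli A f) * hhalf
    rw [key]
    exact neg_mem h1
  · refine ⟨0, 0, ?_⟩
    have h1 := mul_mem_gramIdeal hf hE hF
    have : f ∈ gramIdeal A := by
      rcases Nat.lt_or_ge n 2 with hlt | hge
      · obtain rfl : n = 1 := by omega
        -- For $n=1$ the factor is $-3$; the sign is changed to divide by a natural number.
        refine mem_of_natCast_mul_mem (n := 3) (by norm_num) ?_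
        convert neg_mem h1 using 1
        push_cast
        ring
      · refine mem_of_natCast_mul_mem (n := n ^ 2 * (n + 2) * (n - 2)) ?_ ?_
        · have : n - 2 ≠ 0 := by omega
          positivity
        · convert h1 using 2
          push_cast [Nat.cast_sub hge]
          ring
    simpa using this

/-- The functionals $f\mapsto f(0)$ and $f\mapsto(\Omega_kf)(0)$ kill the ideal: scalar products
vanish to second order at the origin, and their quadratic parts, symmetric in the columns, are
killed by the alternating $\Omega_k$. On the minors they give $(\Omega_km_l)(0)=2\delta_{kl}$. -/
theorem coeff_eq_zero_of_mem {c₀ : A} {c : Fin 3 → A}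
    (h : C c₀ + ∑ k, C (c k) * minor A k ∈ gramIdeal A) : c₀ = 0 ∧ ∀ k, c k = 0 := by
  let ev : MvPolynomial Entry A →ₐ[A] A := aeval fun _ => 0
  have hg : ∀ (p q : Fin 1 ⊕ Fin 1), ev (gram A p q) = 0 ∧
      (∀ x, ev (pderiv x (gram A p q)) = 0) ∧ ∀ k, ev (omega A k (gram A p q)) = 0 := by
    intro p q
    refine ⟨by simp [ev, gram], fun x => by simp [ev, gram], fun k => ?_⟩
    obtain p | p := p <;> obtain q | q := q <;> fin_cases p <;> fin_cases q <;> fin_cases k <;>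
      simp [ev, gram, omega, Fin.sum_univ_three, pderiv_X]
  have hmul : ∀ (r g : MvPolynomial Entry A), ev g = 0 → (∀ z, ev (pderiv z g) = 0) →
      (∀ k, ev (omega A k g) = 0) → ∀ k, ev (omega A k (r * g)) = 0 := by
    intro r g h0 h1 h2 k
    have h2k := h2 k
    simp only [omega, map_sub, sub_eq_zero] at h2k
    simp [omega, Derivation.leibniz, h0, h1, h2k]
  have hev : ∀ f ∈ gramIdeal A, ev f = 0 ∧ ∀ k, ev (omega A k f) = 0 := by
    intro f hf
    obtain ⟨r₀, r₁, r₂, rfl⟩ := Submodule.mem_span_triple.1 hf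
    constructor
    · simp [(hg _ _).1]
    · intro k
      have hadd : ∀ f g, ev (omega A k (f + g)) = ev (omega A k f) + ev (omega A k g) := by
        intro f g
        simp only [omega, map_add, map_sub]
        ring
      simp only [smul_eq_mul, hadd, hmul _ _ (hg _ _).1 (hg _ _).2.1 (hg _ _).2.2, add_zero]
  obtain ⟨h0, hk⟩ := hev _ h
  constructor
  · simpa [ev, minor] using h0
  · have h2 : ∀ k, (2 : A) * c k = 0 := by
      intro k
      rw [← hk k]
      fin_cases k <;>
      · simp [ev, minor, omega, Fin.sum_univ_three, pderiv_X]
        try ring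
    intro k
    have h3 : algebraMap ℂ A (1 / 2) * 2 = 1 := by
      rw [← map_ofNat (algebraMap ℂ A) 2, ← map_mul]
      norm_num
    rw [← one_mul (c k), ← h3, mul_assoc, h2, mul_zero]

/-- The substitution which adds `t` times the row `p` to the row `q`. -/
def shear (p q : Fin 1 ⊕ Fin 1) (t : ℂ) : MvPolynomial Entry A →ₐ[A] MvPolynomial Entry A :=
  aeval fun x => X x + if x.1 = q then C (algebraMap ℂ A t) * X (p, x.2) else 0

theorem shear_isHomogeneous (p q : Fin 1 ⊕ Fin 1) (t : ℂ) {f : MvPolynomial Entry A} {n : ℕ}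
    (hf : f.IsHomogeneous n) : (shear p q t f).IsHomogeneous n := by
  have := hf.aeval (n := 1) (fun x : Entry =>
    (X x + if x.1 = q then C (algebraMap ℂ A t) * X (p, x.2) else 0 : MvPolynomial Entry A)) ?_
  · rwa [one_mul] at this
  · intro x
    refine (isHomogeneous_X A x).add ?_
    split_ifs
    · exact isHomogeneous_C_mul_X _ _
    · exact isHomogeneous_zero _ _ _

theorem eval_genericShear (p q : Fin 1 ⊕ Fin 1) (t : ℂ) (f : MvPolynomial Entry A) :
    (genericShear p q f).eval (C (algebraMap ℂ A t)) = shear p q t f := by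
  induction f using MvPolynomial.induction_on with
  | C c =>
    rw [← MvPolynomial.algebraMap_eq, AlgHom.commutes, AlgHom.commutes]
    simp [Polynomial.algebraMap_apply]
  | add f g hf hg => simp only [map_add, Polynomial.eval_add, hf, hg]
  | mul_X f x hf =>
    rw [map_mul, map_mul, Polynomial.eval_mul, hf]
    congr 1
    simp only [genericShear, shear, aeval_X, Polynomial.eval_add, Polynomial.eval_C]
    split_ifs
    · rw [Polynomial.eval_mul, Polynomial.eval_X, Polynomial.eval_C]
    · rw [Polynomial.eval_zero]

/-- If all values at complex numbers of a polynomial lie in an ideal, so do its coefficients. -/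
theorem coeff_mem_of_forall_eval_mem {R : Type} [CommRing R] [Algebra ℂ R] (I : Ideal R)
    (F : Polynomial R) (h : ∀ t : ℂ, F.eval (algebraMap ℂ R t) ∈ I) (n : ℕ) : F.coeff n ∈ I := by
  rw [← Ideal.Quotient.eq_zero_iff_mem]
  -- Linear functionals on the quotient reduce the claim to a complex polynomial in one variable
  -- that vanishes everywhere.
  refine (Module.forall_dual_apply_eq_zero_iff ℂ _).1 fun φ => ?_
  let L : R →ₗ[ℂ] ℂ := φ ∘ₗ (Ideal.Quotient.mkₐ ℂ I).toLinearMap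
  let G : Polynomial ℂ := ∑ k ∈ Finset.range (F.natDegree + 1), Polynomial.monomial k (L (F.coeff k))
  have hG : G = 0 := by
    refine Polynomial.funext fun t => ?_
    have h1 : L (F.eval (algebraMap ℂ R t)) = 0 := by
      change φ (Ideal.Quotient.mk I _) = 0
      rw [Ideal.Quotient.eq_zero_iff_mem.2 (h t), map_zero]
    rw [Polynomial.eval_zero, ← h1, Polynomial.eval_eq_sum_range (p := F), map_sum,
      Polynomial.eval_finsetSum]
    refine Finset.sum_congr rfl fun k _ => ?_
    rw [Polynomial.eval_monomial, ← map_pow, mul_comm (F.coeff k), ← Algebra.smul_def, map_smul,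
      smul_eq_mul, mul_comm]
  by_cases hn : n ≤ F.natDegree
  · have : G.coeff n = L (F.coeff n) := by
      simp [G, Polynomial.finsetSum_coeff, Polynomial.coeff_monomial, hn]
    rw [hG, Polynomial.coeff_zero] at this
    exact this.symm
  · rw [Polynomial.coeff_eq_zero_of_natDegree_lt (not_le.1 hn), map_zero, map_zero]

theorem polarize_mem_of_shear {f : MvPolynomial Entry A} {p q : Fin 1 ⊕ Fin 1}
    (h : ∀ t, shear p q t f - f ∈ gramIdeal A) : polarize A p q f ∈ gramIdeal A := by
  have := coeff_mem_of_forall_eval_mem (gramIdeal A) (genericShear p q f - Polynomial.C f)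
    (fun t => by
      rw [Polynomial.eval_sub, Polynomial.eval_C, IsScalarTower.algebraMap_apply ℂ A,
        MvPolynomial.algebraMap_eq, eval_genericShear]
      exact h t) 1
  rwa [Polynomial.coeff_sub, (coeff_genericShear f).2, Polynomial.coeff_C_succ, sub_zero] at this

/-- A polynomial which is invariant modulo the ideal under the unipotent substitutions is
congruent to a linear combination of `1` and the minors. -/
theorem exists_of_shear_invariant {f : MvPolynomial Entry A}
    (hE : ∀ t, shear top bot t f - f ∈ gramIdeal A)
    (hF : ∀ t, shear bot top t f - f ∈ gramIdeal A) :
    ∃ (c₀ : A) (c : Fin 3 → A), f - (C c₀ + ∑ k, C (c k) * minor A k) ∈ gramIdeal A := by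
  -- The ideal is homogeneous and the substitutions preserve degrees, so invariance passes to each
  -- homogeneous component.
  have hcomp : ∀ (p q : Fin 1 ⊕ Fin 1), (∀ t, shear p q t f - f ∈ gramIdeal A) → ∀ n,
      polarize A p q (homogeneousComponent n f) ∈ gramIdeal A := by
    intro p q h n
    refine polarize_mem_of_shear fun t => ?_
    have := homogeneousComponent_map (shear p q t).toLinearMap
      (fun n g hg => shear_isHomogeneous p q t hg) n f
    rw [AlgHom.toLinearMap_apply, AlgHom.toLinearMap_apply] at this
    rw [← this, ← map_sub]
    exact homogeneousComponent_mem_gramIdeal (h t) n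
  choose c₀ c hc using fun n => exists_of_isHomogeneous
    (homogeneousComponent_isHomogeneous n f) (hcomp _ _ hE n) (hcomp _ _ hF n)
  refine ⟨∑ n ∈ Finset.range (f.totalDegree + 1), c₀ n,
    fun k => ∑ n ∈ Finset.range (f.totalDegree + 1), c n k, ?_⟩
  have key := sum_mem (t := Finset.range (f.totalDegree + 1)) fun n _ => hc n
  rw [Finset.sum_sub_distrib, sum_homogeneousComponent, Finset.sum_add_distrib,
    Finset.sum_comm] at key
  simpa only [map_sum, Finset.sum_mul] using key

end PairInvariants

/-! ### Coordinates on vector spaces and presentations of the zero fibres -/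

namespace PairInvariants

open MvPolynomial SO3Data

section Coordinates

variable {V ι : Type} [AddCommGroup V] [Module ℂ V] (e : V ≃ₗ[ℂ] (ι → ℂ))

/-- A linear coordinate, as a polynomial function. -/
def coordFun (i : ι) : polyFun V :=
  ⟨fun v => e v i, by exact linear_mem_polyFun ((LinearMap.proj i).comp e.toLinearMap)⟩

theorem coe_aeval_coordFun (p : MvPolynomial ι ℂ) (v : V) :
    (aeval (coordFun e) p).1 v = eval (e v) p := by
  induction p using MvPolynomial.induction_on with
  | C c => rw [← MvPolynomial.algebraMap_eq, AlgHom.commutes]; simp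
  | add p q hp hq => rw [map_add, map_add, ← hp, ← hq]; rfl
  | mul_X p i hp => rw [map_mul, map_mul, ← hp, aeval_X, eval_X]; rfl

theorem aeval_coordFun_bijective [Finite ι] : Function.Bijective (aeval (R := ℂ) (coordFun e)) := by
  have := Fintype.ofFinite ι
  classical
  constructor
  · rw [injective_iff_map_eq_zero]
    intro p hp
    refine MvPolynomial.funext fun x => ?_
    have := coe_aeval_coordFun e p (e.symm x)
    rw [hp, e.apply_symm_apply] at this
    rw [← this, map_zero]
    rfl
  · have hle : polyFun V ≤ ((polyFun V).val.comp (aeval (coordFun e))).range := by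
      refine Algebra.adjoin_le ?_
      rintro _ ⟨φ, rfl⟩
      refine ⟨∑ i, C (φ (e.symm (Pi.single i 1))) * X i, ?_⟩
      funext v
      refine (coe_aeval_coordFun e (∑ i, C (φ (e.symm (Pi.single i 1))) * X i) v).trans ?_
      conv_rhs => rw [← e.symm_apply_apply v, pi_eq_sum_univ' (e v)]
      simp [mul_comm]
    intro F
    obtain ⟨p, hp⟩ := hle F.2
    exact ⟨p, Subtype.ext hp⟩

/-- The algebra of polynomial functions in terms of linear coordinates. -/
def polyFunEquiv [Finite ι] : MvPolynomial ι ℂ ≃ₐ[ℂ] polyFun V :=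
  AlgEquiv.ofBijective (aeval (coordFun e)) (aeval_coordFun_bijective e)

theorem polyFunEquiv_X [Finite ι] (i : ι) : polyFunEquiv e (X i) = coordFun e i := by
  rw [polyFunEquiv, AlgEquiv.ofBijective_apply, aeval_X]

end Coordinates

/-- A description of the coordinate ring of a representation `E` of `Sp(1)` as a polynomial ring
over an algebra `A` of invariants in the entries of a `2 × 3` matrix, such that the map `f` depends
on this matrix only, as `ρ` does. -/
structure MatrixChart (A : Type) [CommRing A] [Algebra ℂ A] (E : Type) [AddCommGroup E]
    [Module ℂ E] (σ : Representation ℂ (SpV (Fin 1)) E) (f : E → spV (Fin 1)) where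
  /-- the projection to the space of matrices -/
  proj : E →ₗ[ℂ] HomWV (Fin 1)
  /-- the description of the coordinate ring -/
  equiv : MvPolynomial Entry A ≃ₐ[ℂ] polyFun E
  equiv_X : ∀ x v, (equiv (X x)).1 v = proj v x.1 x.2
  proj_rep : ∀ g v, proj (σ g v) = homSp g (proj v)
  rep_C : ∀ g c, polyRep σ g (equiv (C c)) = equiv (C c)
  map_eq : ∀ v, f v = rho (proj v)

/-- In rank one, preserving the symplectic form amounts to having determinant one. -/
theorem apply_minor (g : SpV (Fin 1)) : g.1 top top * g.1 bot bot - g.1 top bot * g.1 bot top = 1 := by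
  have h := congrFun (congrFun (SymplecticGroup.mem_iff.1 g.2) bot) top
  simp [Matrix.mul_apply, Matrix.J] at h
  linear_combination h

/-- The transvection adding `t` times the row `bot` to the row `top`. -/
def upper (t : ℂ) : SpV (Fin 1) :=
  ⟨Matrix.fromBlocks 1 (Matrix.of fun _ _ => t) 0 1, by
    rw [SymplecticGroup.mem_iff]
    ext i j
    fin_cases i <;> fin_cases j <;> simp [Matrix.mul_apply, Matrix.J]⟩

/-- The transvection adding `t` times the row `top` to the row `bot`. -/
def lower (t : ℂ) : SpV (Fin 1) :=
  ⟨Matrix.fromBlocks 1 0 (Matrix.of fun _ _ => t) 1, by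
    rw [SymplecticGroup.mem_iff]
    ext i j
    fin_cases i <;> fin_cases j <;> simp [Matrix.mul_apply, Matrix.J]⟩

/-! ### Invariants of a zero fibre presented by a chart -/

namespace MatrixChart

variable {A : Type} [CommRing A] [Algebra ℂ A] {E : Type} [AddCommGroup E] [Module ℂ E]
  {σ : Representation ℂ (SpV (Fin 1)) E} {f : E → spV (Fin 1)} (c : MatrixChart A E σ f)
  (hf : IsPolyMap f)

theorem coe_gram (p q : Fin 1 ⊕ Fin 1) (v : E) :
    (c.equiv (gram A p q)).1 v = (c.proj v * (c.proj v)ᵀ) p q := by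
  simp only [gram, Matrix.mul_apply, Matrix.transpose_apply, Fin.sum_univ_three, map_add, map_mul]
  rw [← c.equiv_X (p, 0), ← c.equiv_X (p, 1), ← c.equiv_X (p, 2), ← c.equiv_X (q, 0),
    ← c.equiv_X (q, 1), ← c.equiv_X (q, 2)]
  rfl

theorem coe_minor (k : Fin 3) (v : E) : (c.equiv (minor A k)).1 v =
    c.proj v top (k + 1) * c.proj v bot (k + 2) - c.proj v top (k + 2) * c.proj v bot (k + 1) := by
  simp only [minor, map_sub, map_mul, ← c.equiv_X (_, _)]
  rfl

/-- Multiplication by $J$ permutes the entries of $ii^T$ up to sign, so the linear forms in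
$ii^*=ii^TJ$ and the scalar products of the rows span the same space. -/
theorem map_gramIdeal : (gramIdeal A).map c.equiv = zeroFibreIdeal f hf := by
  apply le_antisymm
  · rw [gramIdeal, Ideal.map_span, Ideal.span_le]
    have key : ∀ p q (φ : Matrix (Fin 1 ⊕ Fin 1) (Fin 1 ⊕ Fin 1) ℂ →ₗ[ℂ] ℂ),
        (∀ i : HomWV (Fin 1), φ (i * adj i) = (i * iᵀ) p q) →
        c.equiv (gram A p q) ∈ zeroFibreIdeal f hf := by
      intro p q φ h
      refine Ideal.subset_span ⟨φ ∘ₗ Submodule.subtype _, Subtype.ext (funext fun v => ?_)⟩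
      change φ (f v).1 = _
      rw [coe_gram, ← h, c.map_eq]
      rfl
    rintro _ ⟨_, rfl | rfl | rfl, rfl⟩
    · refine key _ _ (-Matrix.entryLinearMap ℂ ℂ top bot) fun i => ?_
      simp [adj, Matrix.mul_apply, Matrix.J, Fin.sum_univ_three]
    · refine key _ _ (Matrix.entryLinearMap ℂ ℂ top top) fun i => ?_
      simp [adj, Matrix.mul_apply, Matrix.J, Fin.sum_univ_three]
    · refine key _ _ (Matrix.entryLinearMap ℂ ℂ bot top) fun i => ?_
      simp [adj, Matrix.mul_apply, Matrix.J, Fin.sum_univ_three]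
  · refine Ideal.span_le.2 ?_
    rintro _ ⟨φ, rfl⟩
    obtain ⟨ψ, hψ⟩ := LinearMap.exists_extend
      (p := skewAdjointMatricesSubmodule (Matrix.J (Fin 1) ℂ)) φ
    have hg : ∀ p q, c.equiv (gram A p q) ∈ (gramIdeal A).map c.equiv := by
      have hs : gram A bot top = gram A top bot := by simp only [gram, mul_comm]
      intro p q
      refine Ideal.mem_map_of_mem _ (Ideal.subset_span ?_)
      obtain p | p := p <;> obtain q | q := q <;> fin_cases p <;> fin_cases q <;> simp [hs]
    have key : (⟨fun v => φ (f v), hf φ⟩ : polyFun E) = ∑ p, ∑ q, ∑ r,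
        algebraMap ℂ (polyFun E) (ψ (Matrix.single p q 1) * Matrix.J (Fin 1) ℂ r q) *
          c.equiv (gram A p r) := by
      refine Subtype.ext (funext fun v => ?_)
      have h1 : φ (f v) = ψ (c.proj v * adj (c.proj v)) := by
        rw [c.map_eq, ← hψ]
        rfl
      have h2 : ∀ p q, (c.proj v * adj (c.proj v)) p q =
          ∑ r, Matrix.J (Fin 1) ℂ r q * (c.equiv (gram A p r)).1 v := by
        intro p q
        rw [adj, ← Matrix.mul_assoc, Matrix.mul_apply]
        simp only [coe_gram, mul_comm]
      change φ (f v) = _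
      rw [h1]
      conv_lhs => rw [Matrix.matrix_eq_sum_single (c.proj v * adj (c.proj v))]
      simp only [map_sum, AddSubmonoidClass.coe_finsetSum, Finset.sum_apply]
      refine Finset.sum_congr rfl fun p _ => Finset.sum_congr rfl fun q _ => ?_
      rw [← mul_one ((c.proj v * adj (c.proj v)) p q), ← smul_eq_mul, ← Matrix.smul_single,
        map_smul, h2, smul_eq_mul, mul_comm, Finset.mul_sum]
      refine Finset.sum_congr rfl fun r _ => ?_
      rw [← mul_assoc]
      rfl
    change (⟨fun v => φ (f v), hf φ⟩ : polyFun E) ∈ _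
    rw [key]
    exact sum_mem fun p _ => sum_mem fun q _ => sum_mem fun r _ => Ideal.mul_mem_left _ _ (hg p r)

/-- Restriction of polynomials to the zero fibre. -/
def restrict : MvPolynomial Entry A →ₐ[ℂ] zeroFibreRing f hf :=
  (toZeroFibre f hf).comp c.equiv.toAlgHom

theorem restrict_eq_zero_iff (p : MvPolynomial Entry A) :
    c.restrict hf p = 0 ↔ p ∈ gramIdeal A := by
  have h1 : c.restrict hf p = 0 ↔ c.equiv p ∈ zeroFibreIdeal f hf :=
    Ideal.Quotient.eq_zero_iff_mem
  rw [h1, ← c.map_gramIdeal hf, ← Ideal.mem_comap,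
    Ideal.comap_map_of_bijective c.equiv c.equiv.bijective]

theorem restrict_surjective : Function.Surjective (c.restrict hf) :=
  (toZeroFibre_surjective f hf).comp c.equiv.surjective

theorem polyRep_X (g : SpV (Fin 1)) (x : Entry) (v : E) :
    (polyRep σ g (c.equiv (X x))).1 v = ((g⁻¹).1 * c.proj v) x.1 x.2 := by
  have h : (polyRep σ g (c.equiv (X x))).1 v = (c.equiv (X x)).1 (σ g⁻¹ v) := rfl
  rw [h, c.equiv_X, c.proj_rep]
  rfl

/-- Multiplication of the matrix by $g^{-1}$ multiplies each minor by $\det g^{-1}=1$. -/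
theorem polyRep_minor (g : SpV (Fin 1)) (k : Fin 3) :
    polyRep σ g (c.equiv (minor A k)) = c.equiv (minor A k) := by
  refine Subtype.ext (funext fun v => ?_)
  have h : (polyRep σ g (c.equiv (minor A k))).1 v = (c.equiv (minor A k)).1 (σ g⁻¹ v) := rfl
  rw [h, coe_minor, coe_minor, c.proj_rep]
  have hd := apply_minor g⁻¹
  have hm : ∀ p j, (homSp g⁻¹ (c.proj v)) p j =
      (g⁻¹).1 p top * c.proj v top j + (g⁻¹).1 p bot * c.proj v bot j := by
    intro p j
    change ((g⁻¹).1 * c.proj v) p j = _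
    simp [Matrix.mul_apply]
  simp only [hm]
  linear_combination (c.proj v top (k + 1) * c.proj v bot (k + 2) -
    c.proj v top (k + 2) * c.proj v bot (k + 1)) * hd

theorem polyRep_shear (g : SpV (Fin 1)) (p q : Fin 1 ⊕ Fin 1) (t : ℂ)
    (hg : ∀ (i : HomWV (Fin 1)) r j, ((g⁻¹).1 * i) r j = i r j + if r = q then t * i p j else 0)
    (F : MvPolynomial Entry A) : polyRep σ g (c.equiv F) = c.equiv (shear p q t F) := by
  induction F using MvPolynomial.induction_on with
  | C a =>
    rw [c.rep_C, ← MvPolynomial.algebraMap_eq, AlgHom.commutes]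
  | add F G hF hG => simp only [map_add, hF, hG]
  | mul_X F x hF =>
    simp only [map_mul, hF]
    congr 1
    refine Subtype.ext (funext fun v => ?_)
    rw [polyRep_X, hg, shear, aeval_X, map_add, ← c.equiv_X x]
    congr 1
    split_ifs with h
    · rw [map_mul, ← c.equiv_X (p, x.2), ← MvPolynomial.algebraMap_eq,
        ← IsScalarTower.algebraMap_apply, AlgEquiv.commutes]
      rfl
    · rw [map_zero]
      rfl

variable {τ : Representation ℂ (SpV (Fin 1)) (spV (Fin 1))} (heq : ∀ g v, f (σ g v) = τ g (f v))

theorem restrict_C_mem (a : A) : c.restrict hf (C a) ∈ invariants (zeroFibreRep σ τ f hf heq) :=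
  fun g => congrArg (toZeroFibre f hf) (c.rep_C g a)

theorem restrict_minor_mem (k : Fin 3) :
    c.restrict hf (minor A k) ∈ invariants (zeroFibreRep σ τ f hf heq) :=
  fun g => congrArg (toZeroFibre f hf) (c.polyRep_minor g k)

/-- Invariance under the two families of transvections already suffices. -/
theorem exists_of_mem_invariants {r : zeroFibreRing f hf}
    (hr : r ∈ invariants (zeroFibreRep σ τ f hf heq)) :
    ∃ (a₀ : A) (a : Fin 3 → A), r = c.restrict hf (C a₀ + ∑ k, C (a k) * minor A k) := by
  obtain ⟨F, rfl⟩ := c.restrict_surjective hf r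
  have hs : ∀ (g : SpV (Fin 1)) p q t, (∀ (i : HomWV (Fin 1)) r j, ((g⁻¹).1 * i) r j =
      i r j + if r = q then t * i p j else 0) → shear p q t F - F ∈ gramIdeal A := by
    intro g p q t hg
    rw [← c.restrict_eq_zero_iff hf, map_sub, sub_eq_zero, ← hr g]
    exact congrArg (toZeroFibre f hf) (c.polyRep_shear g p q t hg F).symm
  obtain ⟨a₀, a, h⟩ := exists_of_shear_invariant (f := F)
    -- Functions transform by $g^{-1}$, hence the inverse transvection.
    (fun t => hs (lower t)⁻¹ top bot t fun i r j => by
      rw [inv_inv]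
      obtain r | r := r <;> fin_cases r <;> simp [lower, Matrix.mul_apply, add_comm])
    (fun t => hs (upper t)⁻¹ bot top t fun i r j => by
      rw [inv_inv]
      obtain r | r := r <;> fin_cases r <;> simp [upper, Matrix.mul_apply])
  refine ⟨a₀, a, ?_⟩
  rw [← sub_eq_zero, ← map_sub, c.restrict_eq_zero_iff hf]
  exact h

theorem restrict_minor_mul_minor (k l : Fin 3) :
    c.restrict hf (minor A k) * c.restrict hf (minor A l) = 0 := by
  rw [← map_mul, c.restrict_eq_zero_iff]
  exact minor_mul_minor_mem k l

end MatrixChart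

end PairInvariants

/-! ### The ring `ℂ[x, y, z] / (x, y, z)²` and the two quotients -/

namespace PairInvariants

open MvPolynomial SO3Data TensorProduct

/-- The coordinates on the fat point. -/
def fatX (k : Fin 3) : FatRing := Ideal.Quotient.mk fatIdeal (X k)

theorem fatX_mul_fatX (k l : Fin 3) : fatX k * fatX l = 0 := by
  rw [fatX, fatX, ← map_mul, Ideal.Quotient.eq_zero_iff_mem, fatIdeal, pow_two]
  refine Ideal.mul_mem_mul (Ideal.subset_span ?_) (Ideal.subset_span ?_)
  · fin_cases k <;> simp
  · fin_cases l <;> simp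

theorem exists_eq_fatX (r : FatRing) :
    ∃ (a₀ : ℂ) (a : Fin 3 → ℂ), r = algebraMap ℂ _ a₀ + ∑ k, a k • fatX k := by
  obtain ⟨p, rfl⟩ := Ideal.Quotient.mk_surjective r
  induction p using MvPolynomial.induction_on with
  | C c => exact ⟨c, 0, by simp; rfl⟩
  | add p q hp hq =>
    obtain ⟨a₀, a, ha⟩ := hp
    obtain ⟨b₀, b, hb⟩ := hq
    refine ⟨a₀ + b₀, a + b, ?_⟩
    rw [map_add, ha, hb, map_add]
    simp only [Pi.add_apply, add_smul, Finset.sum_add_distrib]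
    abel
  | mul_X p j hp =>
    obtain ⟨a₀, a, ha⟩ := hp
    refine ⟨0, Pi.single j a₀, ?_⟩
    have hX : Ideal.Quotient.mk fatIdeal (X j) = fatX j := rfl
    rw [map_mul, ha, hX, add_mul, Finset.sum_mul]
    simp only [smul_mul_assoc, fatX_mul_fatX, smul_zero, Finset.sum_const_zero, add_zero, map_zero,
      zero_add, ← Algebra.smul_def]
    rw [Finset.sum_eq_single j (fun k _ hk => by rw [Pi.single_eq_of_ne hk, zero_smul])
      (by simp), Pi.single_eq_same]

/-- Homomorphisms from `ℂ[x, y, z] / (x, y, z)²`. -/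
def fatLift {S : Type} [CommRing S] [Algebra ℂ S] (m : Fin 3 → S) (hm : ∀ k l, m k * m l = 0) :
    FatRing →ₐ[ℂ] S :=
  Ideal.Quotient.liftₐ fatIdeal (aeval m) fun p hp => by
    have h : fatIdeal ≤ RingHom.ker (aeval m : MvPolynomial (Fin 3) ℂ →ₐ[ℂ] S) := by
      rw [fatIdeal, pow_two, Ideal.span_mul_span', Ideal.span_le]
      have hX : ∀ k l, (X k * X l : MvPolynomial (Fin 3) ℂ) ∈ RingHom.ker (aeval (R := ℂ) m) := by
        intro k l
        rw [RingHom.mem_ker, map_mul, aeval_X, aeval_X, hm]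
      rintro _ ⟨_, rfl | rfl | rfl, _, rfl | rfl | rfl, rfl⟩ <;> exact hX _ _
    exact h hp

theorem fatLift_fatX {S : Type} [CommRing S] [Algebra ℂ S] (m : Fin 3 → S)
    (hm : ∀ k l, m k * m l = 0) (k : Fin 3) : fatLift m hm (fatX k) = m k := by
  refine (Ideal.Quotient.lift_mk fatIdeal _ _).trans ?_
  exact aeval_X m k

/-! ### The invariants for $\rho$ and the action of $\mathrm{SO}(3)$ -/

section Rho

/-- The coordinate ring of `Hom(W, V)`. -/
def rhoChart : MatrixChart ℂ (HomWV (Fin 1)) homSp rho where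
  proj := LinearMap.id
  equiv := polyFunEquiv ((Matrix.ofLinearEquiv ℂ).symm ≪≫ₗ
    (LinearEquiv.curry ℂ ℂ (Fin 1 ⊕ Fin 1) (Fin 3)).symm)
  equiv_X x v := by
    rw [polyFunEquiv_X]
    rfl
  proj_rep _ _ := rfl
  rep_C g c := by
    rw [← MvPolynomial.algebraMap_eq, AlgEquiv.commutes, AlgHom.commutes]
  map_eq _ := rfl

/-- The map `i ↦ i* i = iᵀ J i` to skew-symmetric matrices. -/
def skewForm (i : HomWV (Fin 1)) : o3 :=
  ⟨iᵀ * Matrix.J (Fin 1) ℂ * i, by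
    rw [mem_o3]
    simp [Matrix.mul_assoc]⟩

/-- The coordinates on `𝔬(3)` which pull back to the minors. -/
def o3Equiv : o3 ≃ₗ[ℂ] (Fin 3 → ℂ) where
  toFun A k := -A.1 (k + 1) (k + 2)
  map_add' A B := by
    ext k
    simp [add_comm]
  map_smul' c A := by
    ext k
    simp
  invFun c := ⟨!![0, -c 2, c 1; c 2, 0, -c 0; -c 1, c 0, 0], by
    rw [mem_o3]
    ext i j
    fin_cases i <;> fin_cases j <;> simp⟩
  left_inv A := by
    have h := (mem_o3 A.1).1 A.2
    have h' : ∀ i j, A.1 i j = -A.1 j i := fun i j => congrFun (congrFun h j) i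
    have hd : ∀ i, A.1 i i = 0 := fun i => self_eq_neg.1 (h' i i)
    refine Subtype.ext ?_
    ext i j
    fin_cases i <;> fin_cases j <;> simp [hd] <;> exact (h' _ _).symm
  right_inv c := by
    ext k
    fin_cases k <;> simp

theorem o3Equiv_skewForm (i : HomWV (Fin 1)) (k : Fin 3) :
    o3Equiv (skewForm i) k = (rhoChart.equiv (minor ℂ k)).1 i := by
  rw [MatrixChart.coe_minor]
  change -(iᵀ * Matrix.J (Fin 1) ℂ * i) (k + 1) (k + 2) = i _ _ * i _ _ - i _ _ * i _ _
  simp [Matrix.mul_apply, Matrix.J]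
  ring

theorem skewForm_homSO (h : SO3) (i : HomWV (Fin 1)) :
    skewForm (homSO h i) = adSO h (skewForm i) := by
  refine Subtype.ext ?_
  change (i * (h⁻¹).1)ᵀ * Matrix.J (Fin 1) ℂ * (i * (h⁻¹).1) =
    h.1 * (iᵀ * Matrix.J (Fin 1) ℂ * i) * (h⁻¹).1
  rw [SO3.coe_inv, Matrix.transpose_mul, Matrix.transpose_transpose]
  simp only [Matrix.mul_assoc]

/-- The pull-back of a linear form on `𝔬(3)`, as a polynomial. -/
def formPoly (φ : Module.Dual ℂ o3) : MvPolynomial Entry ℂ :=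
  ∑ k, C (φ (o3Equiv.symm (Pi.single k 1))) * minor ℂ k

theorem coe_formPoly (φ : Module.Dual ℂ o3) (i : HomWV (Fin 1)) :
    (rhoChart.equiv (formPoly φ)).1 i = φ (skewForm i) := by
  have h : φ (skewForm i) = ∑ k, φ (o3Equiv.symm (Pi.single k 1)) * o3Equiv (skewForm i) k := by
    conv_lhs => rw [← o3Equiv.symm_apply_apply (skewForm i), pi_eq_sum_univ' (o3Equiv (skewForm i))]
    simp [mul_comm]
  simp only [h, o3Equiv_skewForm, formPoly, ← smul_eq_C_mul, map_sum, map_smul]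
  simp [Fin.sum_univ_three]

theorem formPoly_sum_coord (b : Module.Basis (Fin 3) ℂ o3) (φ : Module.Dual ℂ o3) :
    formPoly φ = ∑ k, φ (b k) • formPoly (b.coord k) := by
  have h : ∀ v, φ v = ∑ k, φ (b k) * b.coord k v := by
    intro v
    conv_lhs => rw [← b.sum_repr v, map_sum]
    simp only [map_smul, smul_eq_mul, mul_comm, Module.Basis.coord_apply]
  simp only [formPoly, ← smul_eq_C_mul, Finset.smul_sum, smul_smul]
  rw [Finset.sum_comm]
  refine Finset.sum_congr rfl fun j _ => ?_
  rw [h, Finset.sum_smul]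

theorem restrict_formPoly_mul (φ ψ : Module.Dual ℂ o3) :
    rhoChart.restrict isPolyMap_rho (formPoly φ) * rhoChart.restrict isPolyMap_rho (formPoly ψ) =
      0 := by
  simp only [formPoly, ← smul_eq_C_mul, map_sum, map_smul, Finset.sum_mul_sum, smul_mul_smul_comm,
    MatrixChart.restrict_minor_mul_minor, smul_zero, Finset.sum_const_zero]

theorem restrict_formPoly_mem (φ : Module.Dual ℂ o3) :
    rhoChart.restrict isPolyMap_rho (formPoly φ) ∈ invariants (rhoSp (Fin 1)) := by
  simp only [formPoly, ← smul_eq_C_mul, map_sum, map_smul]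
  exact sum_mem fun k _ => Subalgebra.smul_mem _ (rhoChart.restrict_minor_mem _ rho_homSp k) _

/-- The pull-back of a linear form on `𝔬(3)`, as an invariant. -/
def formInv (φ : Module.Dual ℂ o3) : RhoInv (Fin 1) :=
  ⟨rhoChart.restrict isPolyMap_rho (formPoly φ), restrict_formPoly_mem φ⟩

/-- The homomorphism to the invariants defined by coordinates on `𝔬(3)`. -/
def fatToInv (b : Module.Basis (Fin 3) ℂ o3) : FatRing →ₐ[ℂ] RhoInv (Fin 1) :=
  fatLift (fun k => formInv (b.coord k)) fun _ _ => Subtype.ext (restrict_formPoly_mul _ _)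

/-- With coefficients given by a linear form $\varphi$, the image does not depend on the basis.
Bijectivity for every basis thereby reduces to the statements about minors. -/
theorem coe_fatToInv (b : Module.Basis (Fin 3) ℂ o3) (a₀ : ℂ) (φ : Module.Dual ℂ o3) :
    (fatToInv b (algebraMap ℂ _ a₀ + ∑ k, φ (b k) • fatX k)).1 =
      rhoChart.restrict isPolyMap_rho (C a₀ + formPoly φ) := by
  rw [map_add, map_add, AlgHom.commutes, ← MvPolynomial.algebraMap_eq, AlgHom.commutes,
    formPoly_sum_coord b, map_sum, map_sum]
  simp only [map_smul, fatToInv, fatLift_fatX]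
  rw [Subalgebra.coe_add, AddSubmonoidClass.coe_finsetSum]
  rfl

theorem fatToInv_bijective (b : Module.Basis (Fin 3) ℂ o3) : Function.Bijective (fatToInv b) := by
  constructor
  · rw [injective_iff_map_eq_zero]
    intro r hr
    obtain ⟨a₀, a, rfl⟩ := exists_eq_fatX r
    -- Arbitrary coefficients are the values on `b` of a unique linear form.
    have ha : ∀ k, b.constr ℂ a (b k) = a k := fun k => b.constr_basis ℂ a k
    have h := coe_fatToInv b a₀ (b.constr ℂ a)
    simp only [ha] at h
    rw [hr] at h
    have h' := (rhoChart.restrict_eq_zero_iff _ _).1 h.symm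
    obtain ⟨h0, hk⟩ := coeff_eq_zero_of_mem h'
    have hφ : b.constr ℂ a = 0 := by
      refine LinearMap.ext fun v => ?_
      rw [← o3Equiv.symm_apply_apply v, pi_eq_sum_univ' (o3Equiv v)]
      simp [hk]
    have ha' : ∀ k, a k = 0 := fun k => by rw [← ha, hφ, LinearMap.zero_apply]
    simp [h0, ha']
  · intro r
    obtain ⟨a₀, a, h⟩ := rhoChart.exists_of_mem_invariants _ rho_homSp r.2
    let φ : Module.Dual ℂ o3 := (Fintype.linearCombination ℂ a).comp o3Equiv.toLinearMap
    have hφ : ∀ k, φ (o3Equiv.symm (Pi.single k 1)) = a k := by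
      intro k
      simp [φ]
    refine ⟨algebraMap ℂ _ a₀ + ∑ k, φ (b k) • fatX k, Subtype.ext ?_⟩
    rw [coe_fatToInv, formPoly, h]
    simp only [hφ]

/-- Equivariance of $i\mapsto i^TJi$ turns the action on invariants into the action on linear forms
on $\mathfrak o(3)$, which is then expanded in the dual basis. -/
theorem rhoInvSO_formInv (b : Module.Basis (Fin 3) ℂ o3) (h : SO3) (k : Fin 3) :
    rhoInvSO (Fin 1) h (formInv (b.coord k)) =
      ∑ j, b.coord k (adSO h⁻¹ (b j)) • formInv (b.coord j) := by
  have key : polyRep homSO h (rhoChart.equiv (formPoly (b.coord k))) =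
      rhoChart.equiv (∑ j, b.coord k (adSO h⁻¹ (b j)) • formPoly (b.coord j)) := by
    have hsum := formPoly_sum_coord b ((b.coord k).comp (adSO h⁻¹))
    simp only [LinearMap.comp_apply] at hsum
    rw [← hsum]
    refine Subtype.ext (funext fun i => ?_)
    rw [coe_formPoly]
    refine (coe_formPoly (b.coord k) (homSO h⁻¹ i)).trans ?_
    rw [skewForm_homSO]
    rfl
  refine Subtype.ext ((congrArg (toZeroFibre rho isPolyMap_rho) key).trans ?_)
  rw [AddSubmonoidClass.coe_finsetSum]
  exact (map_sum (rhoChart.restrict isPolyMap_rho) _ _).trans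
    (Finset.sum_congr rfl fun j _ => map_smul _ _ _)

theorem rhoInvSO_fatToInv (b : Module.Basis (Fin 3) ℂ o3) (h : SO3) (r : FatRing) :
    rhoInvSO (Fin 1) h (fatToInv b r) = fatToInv b (fatRep b adSO h r) := by
  obtain ⟨a₀, a, rfl⟩ := exists_eq_fatX r
  have hX : ∀ k, fatRep b adSO h (fatX k) = ∑ j, b.coord k (adSO h⁻¹ (b j)) • fatX j := by
    intro k
    have h1 : fatRep b adSO h (fatX k) = Ideal.Quotient.mk fatIdeal (coordAct b adSO h (X k)) := rfl
    rw [h1, coordAct, aeval_X, map_sum]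
    rfl
  simp only [map_add, map_sum, map_smul, AlgHom.commutes, hX]
  simp only [fatToInv, fatLift_fatX, rhoInvSO_formInv]

end Rho

/-! ### The invariants for $\mu_{(2)}$ -/

section Mu

/-- Self-adjointness makes $JB$ skew-symmetric, and a skew-symmetric $2\times 2$ matrix is a
multiple of $J$. -/
theorem pV_eq_smul_one (B : pV (Fin 1)) : B.1 = B.1 top top • (1 : Matrix _ _ ℂ) := by
  have h := (mem_pV B.1).1 B.2
  have h' := fun i j => congrFun (congrFun h i) j
  simp only [Matrix.mul_apply, Fintype.sum_sum_type, Finset.univ_unique, Finset.sum_singleton,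
    Matrix.transpose_apply] at h'
  have h1 := h' top top
  have h2 := h' top bot
  have h3 := h' bot bot
  simp [Matrix.J] at h1 h2 h3
  ext i j
  fin_cases i <;> fin_cases j <;> simp
  · exact neg_eq_self.1 h3
  · exact self_eq_neg.1 h1
  · exact h2.symm

theorem smul_one_mem_pV (a : ℂ) : a • (1 : Matrix _ _ ℂ) ∈
    selfAdjointMatricesSubmodule (Matrix.J (Fin 1) ℂ) := by
  rw [mem_pV]
  simp

theorem conjP_apply (g : SpV (Fin 1)) (B : pV (Fin 1)) : conjP g B = B := by
  refine Subtype.ext ?_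
  change g.1 * B.1 * (g⁻¹).1 = B.1
  rw [pV_eq_smul_one B, Matrix.mul_smul, Matrix.smul_mul, Matrix.mul_one, coe_mul_inv]

/-- The coordinates on `N` for `Sp(1)`. -/
def admEquiv : ADHM (Fin 1) ≃ₗ[ℂ] (Entry ⊕ Fin 2 → ℂ) where
  toFun x := Sum.elim (fun e => x.2.2 e.1 e.2) ![x.1.1 top top, x.2.1.1 top top]
  map_add' x y := by
    ext i
    obtain i | i := i
    · rfl
    · fin_cases i <;> rfl
  map_smul' c x := by
    ext i
    obtain i | i := i
    · rfl
    · fin_cases i <;> rfl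
  invFun v := (⟨v (Sum.inr 0) • 1, smul_one_mem_pV _⟩, ⟨v (Sum.inr 1) • 1, smul_one_mem_pV _⟩,
    fun p k => v (Sum.inl (p, k)))
  left_inv x := by
    refine Prod.ext (Subtype.ext ?_) (Prod.ext (Subtype.ext ?_) rfl)
    · exact (pV_eq_smul_one x.1).symm
    · exact (pV_eq_smul_one x.2.1).symm
  right_inv v := by
    ext i
    obtain i | i := i
    · rfl
    · fin_cases i <;> simp

/-- The coordinate ring of `N`, as a polynomial ring over the coordinate ring of the plane. -/
def muChart : MatrixChart (MvPolynomial (Fin 2) ℂ) (ADHM (Fin 1)) admSp mu where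
  proj := (LinearMap.snd ℂ _ _).comp (LinearMap.snd ℂ _ _)
  equiv := (sumAlgEquiv ℂ Entry (Fin 2)).symm.trans (polyFunEquiv admEquiv)
  equiv_X x v := by
    rw [AlgEquiv.trans_apply, sumAlgEquiv_symm_X, polyFunEquiv_X]
    rfl
  proj_rep _ _ := rfl
  rep_C g c := by
    have h : ((polyRep admSp g).comp ((sumAlgEquiv ℂ Entry (Fin 2)).symm.trans
        (polyFunEquiv admEquiv)).toAlgHom).comp (Algebra.algHom ℂ (MvPolynomial (Fin 2) ℂ)
          (MvPolynomial Entry (MvPolynomial (Fin 2) ℂ))) =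
        (((sumAlgEquiv ℂ Entry (Fin 2)).symm.trans
        (polyFunEquiv admEquiv)).toAlgHom).comp (Algebra.algHom ℂ (MvPolynomial (Fin 2) ℂ)
          (MvPolynomial Entry (MvPolynomial (Fin 2) ℂ))) := by
      refine algHom_ext fun k => ?_
      change polyRep admSp g (polyFunEquiv admEquiv ((sumAlgEquiv ℂ Entry (Fin 2)).symm (C (X k)))) =
        polyFunEquiv admEquiv ((sumAlgEquiv ℂ Entry (Fin 2)).symm (C (X k)))
      rw [sumAlgEquiv_symm_C_X, polyFunEquiv_X]
      refine Subtype.ext (funext fun x => ?_)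
      change ![(conjP g⁻¹ x.1).1 top top, (conjP g⁻¹ x.2.1).1 top top] k =
        ![x.1.1 top top, x.2.1.1 top top] k
      rw [conjP_apply, conjP_apply]
    exact congrArg (fun T => T c) h
  map_eq x := by
    refine Subtype.ext ?_
    -- The commutator vanishes because $B_1$ is a scalar.
    change x.1.1 * x.2.1.1 - x.2.1.1 * x.1.1 + (rho x.2.2).1 = (rho x.2.2).1
    rw [pV_eq_smul_one x.1, Matrix.smul_mul, Matrix.mul_smul, Matrix.one_mul, Matrix.mul_one,
      sub_self, zero_add]

/-- The inclusion of the coordinate ring of the plane into the invariants. -/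
def planeToInv : MvPolynomial (Fin 2) ℂ →ₐ[ℂ] invariants (muSp (Fin 1)) :=
  ((muChart.restrict isPolyMap_mu).comp (Algebra.algHom ℂ (MvPolynomial (Fin 2) ℂ)
    (MvPolynomial Entry (MvPolynomial (Fin 2) ℂ)))).codRestrict (invariants (muSp (Fin 1)))
      fun a => muChart.restrict_C_mem isPolyMap_mu mu_admSp a

/-- The homomorphism from `ℂ[x, y, z] / (x, y, z)²` to the invariants given by the minors. -/
def fatToMuInv : FatRing →ₐ[ℂ] invariants (muSp (Fin 1)) :=
  fatLift (fun k => ⟨muChart.restrict isPolyMap_mu (minor _ k),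
    muChart.restrict_minor_mem isPolyMap_mu mu_admSp k⟩)
    fun k l => Subtype.ext (muChart.restrict_minor_mul_minor isPolyMap_mu k l)

/-- The homomorphism from the coordinate ring of `𝔸² × F` to the invariants. -/
def planeFatToInv : MvPolynomial (Fin 2) ℂ ⊗[ℂ] FatRing →ₐ[ℂ] invariants (muSp (Fin 1)) :=
  Algebra.TensorProduct.lift planeToInv fatToMuInv fun _ _ => Commute.all _ _

theorem exists_eq_tmul_fatX (r : MvPolynomial (Fin 2) ℂ ⊗[ℂ] FatRing) :
    ∃ (a₀ : MvPolynomial (Fin 2) ℂ) (a : Fin 3 → MvPolynomial (Fin 2) ℂ),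
      r = a₀ ⊗ₜ 1 + ∑ k, a k ⊗ₜ fatX k := by
  induction r using TensorProduct.induction_on with
  | zero => exact ⟨0, 0, by simp⟩
  | tmul p r =>
    obtain ⟨a₀, a, rfl⟩ := exists_eq_fatX r
    refine ⟨a₀ • p, fun k => a k • p, ?_⟩
    simp only [tmul_add, tmul_sum, tmul_smul, smul_tmul', Algebra.algebraMap_eq_smul_one]
  | add r s hr hs =>
    obtain ⟨a₀, a, rfl⟩ := hr
    obtain ⟨b₀, b, rfl⟩ := hs
    refine ⟨a₀ + b₀, a + b, ?_⟩
    simp only [Pi.add_apply, add_tmul, Finset.sum_add_distrib]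
    abel

theorem coe_planeFatToInv (a₀ : MvPolynomial (Fin 2) ℂ) (a : Fin 3 → MvPolynomial (Fin 2) ℂ) :
    (planeFatToInv (a₀ ⊗ₜ 1 + ∑ k, a k ⊗ₜ fatX k)).1 =
      muChart.restrict isPolyMap_mu (C a₀ + ∑ k, C (a k) * minor _ k) := by
  simp only [planeFatToInv, map_add, map_sum, map_mul, Algebra.TensorProduct.lift_tmul, map_one,
    mul_one, fatToMuInv, fatLift_fatX]
  rw [Subalgebra.coe_add, AddSubmonoidClass.coe_finsetSum]
  rfl

/-- Each tensor has the form $a_0\otimes 1+\sum_k a_k\otimes x_k$ and maps to the class of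
$a_0+\sum_k a_km_k$. Independence and spanning of $1,m_1,m_2,m_3$ over $A=\mathbb C[\mathbb A^2]$
give injectivity and surjectivity. -/
theorem planeFatToInv_bijective : Function.Bijective planeFatToInv := by
  constructor
  · rw [injective_iff_map_eq_zero]
    intro r hr
    obtain ⟨a₀, a, rfl⟩ := exists_eq_tmul_fatX r
    have h := coe_planeFatToInv a₀ a
    rw [hr] at h
    obtain ⟨h0, hk⟩ := coeff_eq_zero_of_mem ((muChart.restrict_eq_zero_iff _ _).1 h.symm)
    simp [h0, hk]
  · intro r
    obtain ⟨a₀, a, h⟩ := muChart.exists_of_mem_invariants _ mu_admSp r.2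
    exact ⟨_, Subtype.ext ((coe_planeFatToInv a₀ a).trans h.symm)⟩

/-! ### Passage from algebras to schemes over $\mathbb C$ -/

open AlgebraicGeometry CategoryTheory

/-- Isomorphic algebras have isomorphic spectra over the base. -/
def specOverIso {R S : Type} [CommRing R] [CommRing S] [Algebra ℂ R] [Algebra ℂ S] (e : R ≃ₐ[ℂ] S) :
    Over.mk (Spec.map (CommRingCat.ofHom (algebraMap ℂ S))) ≅
      Over.mk (Spec.map (CommRingCat.ofHom (algebraMap ℂ R))) :=
  Over.isoMk (Scheme.Spec.mapIso (RingEquiv.toCommRingCatIso (e : R ≃+* S)).op) (by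
    change Spec.map (CommRingCat.ofHom (e : R ≃+* S).toRingHom) ≫
      Spec.map (CommRingCat.ofHom (algebraMap ℂ R)) = Spec.map (CommRingCat.ofHom (algebraMap ℂ S))
    rw [← Spec.map_comp, ← CommRingCat.ofHom_comp]
    congr 2
    exact RingHom.ext fun c => e.commutes c)

section

variable {C : Type*} [Category C] {X X' Y S : C} (f : X ⟶ S) (f' : X' ⟶ S) (g : Y ⟶ S)
  [Limits.HasPullback f g] [Limits.HasPullback f' g] (e : X ≅ X') (h : e.hom ≫ f' = f)

/-- Isomorphic objects over a base have isomorphic base changes. -/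
def pullbackIso : Limits.pullback f g ≅ Limits.pullback f' g :=
  asIso (Limits.pullback.map f g f' g e.hom (𝟙 Y) (𝟙 S) (by rw [Category.comp_id, h])
    (by rw [Category.comp_id, Category.id_comp]))

theorem pullbackIso_hom_fst :
    (pullbackIso f f' g e h).hom ≫ Limits.pullback.fst f' g = Limits.pullback.fst f g ≫ e.hom :=
  Limits.pullback.lift_fst _ _ _

end

/-- Compatibility with the structure maps, needed to replace $\mathbb A^2$ by
$\mathrm{Spec}\,\mathbb C[\mathbb A^2]$ in the fibre product, which then is the spectrum of a tensor
product. -/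
theorem specIso_hom_comp : (AffineSpace.SpecIso (Fin 2) (CommRingCat.of ℂ)).hom ≫
    Spec.map (CommRingCat.ofHom (algebraMap ℂ (MvPolynomial (Fin 2) ℂ))) =
      (𝔸(Fin 2; Spec (CommRingCat.of ℂ)) ↘ Spec (CommRingCat.of ℂ)) := by
  rw [← Iso.eq_inv_comp, AffineSpace.SpecIso_inv_over]
  rfl

/-- The product of the affine plane with the spectrum of an algebra. -/
def planeTimesSpecIso (R : Type) [CommRing R] [Algebra ℂ R] :
    Limits.pullback (𝔸(Fin 2; Spec (CommRingCat.of ℂ)) ↘ Spec (CommRingCat.of ℂ))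
      (Spec.map (CommRingCat.ofHom (algebraMap ℂ R))) ≅
    Spec (CommRingCat.of (MvPolynomial (Fin 2) ℂ ⊗[ℂ] R)) :=
  pullbackIso _ _ _ _ specIso_hom_comp ≪≫ pullbackSpecIso ℂ (MvPolynomial (Fin 2) ℂ) R

theorem planeTimesSpecIso_hom_comp (R : Type) [CommRing R] [Algebra ℂ R] :
    (planeTimesSpecIso R).hom ≫
      Spec.map (CommRingCat.ofHom (algebraMap ℂ (MvPolynomial (Fin 2) ℂ ⊗[ℂ] R))) =
    Limits.pullback.fst _ _ ≫ (𝔸(Fin 2; Spec (CommRingCat.of ℂ)) ↘ Spec (CommRingCat.of ℂ)) := by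
  rw [planeTimesSpecIso, Iso.trans_hom, Category.assoc, pullbackSpecIso_hom_base,
    ← Category.assoc, pullbackIso_hom_fst, Category.assoc, specIso_hom_comp]

/-- The product `𝔸² × F` is the spectrum of the tensor product. -/
def planeTimesFatPointIso : planeTimesFatPoint ≅ Over.mk (Spec.map (CommRingCat.ofHom
    (algebraMap ℂ (MvPolynomial (Fin 2) ℂ ⊗[ℂ] FatRing)))) :=
  Over.isoMk (planeTimesSpecIso FatRing) (planeTimesSpecIso_hom_comp FatRing)

/-- The isomorphism from the coordinate ring of `𝔸² × F` to the invariants. -/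
def planeFatEquiv : (MvPolynomial (Fin 2) ℂ ⊗[ℂ] FatRing) ≃ₐ[ℂ] invariants (muSp (Fin 1)) :=
  AlgEquiv.ofBijective planeFatToInv planeFatToInv_bijective

/-- The quotient of the zero fibre of `μ` is `𝔸² × F`. -/
def muQuotientIso : muQuotient (Fin 1) ≅ planeTimesFatPoint :=
  specOverIso planeFatEquiv ≪≫ planeTimesFatPointIso.symm

end Mu

end PairInvariants

end

theorem corollaryA :
    (∀ b : Module.Basis (Fin 3) ℂ SO3Data.o3,
      ∃ Φ : SO3Data.RhoInv (Fin 1) ≃ₐ[ℂ] SO3Data.FatRing,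
        ∀ (h : SO3Data.SO3) (r : SO3Data.RhoInv (Fin 1)),
          Φ (SO3Data.rhoInvSO (Fin 1) h r) = SO3Data.fatRep b SO3Data.adSO h (Φ r)) ∧
    Nonempty (CategoryTheory.Iso (SO3Data.muQuotient (Fin 1)) SO3Data.planeTimesFatPoint) := by
  refine ⟨fun b => ?_, ⟨PairInvariants.muQuotientIso⟩⟩
  let Ψ := AlgEquiv.ofBijective (PairInvariants.fatToInv b) (PairInvariants.fatToInv_bijective b)
  -- Equivariance is known for `Ψ`; injectivity transfers it to the inverse.
  refine ⟨Ψ.symm, fun h r => Ψ.injective ?_⟩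
  obtain ⟨s, rfl⟩ := Ψ.surjective r
  rw [Ψ.symm_apply_apply, Ψ.apply_symm_apply]
  exact PairInvariants.rhoInvSO_fatToInv b h s
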